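/- **Strong swing lemma.** Let $L$ be a finite semimodular lattice (that is, $x\preceq y$ implies $x\vee z\preceq y\vee z$, where $x \preceq y$ means that $x=y$ or $x$ is covered by $y$) with a fixed planar Hasse diagram: edges are straight line segments, larger elements are placed higher, and two edges meet only in common endpoints. A prime interval (edge) is $\mathfrak r=[0_{\mathfrak r},1_{\mathfrak r}]$ with $0_{\mathfrak r}\prec 1_{\mathfrak r}$, and $\mathrm{con}(\mathfrak r)$ is the least lattice congruence collapsing $0_{\mathfrak r}$ and $1_{\mathfrak r}$. If $a<b$, $a\nprec b$, and $C_1,C_2$ are maximal chains of $[a,b]$ with $C_1\cap C_2=\{a,b\}$ such that all elements of $C_2\setminus\{a,b\}$ are on the right of $C_1$, then the set of elements of $[a,b]$ that are on the right of $C_1$ and on the left of $C_2$ is a *region* (the elements of a chain count as being on both of its sides). A minimal region is a *cell*; a *4-cell* is a cell formed by four vertices and four edges. An *eye* is a (both meet and join) irreducible element $x$ whose unique lower cover $x_*$ has at least three covers and which is neither the leftmost nor the rightmost cover of $x_*$. Let $\mathfrak r\ne\mathfrak s$ be prime intervals that are sides of the same 4-cell $S$. * $\mathfrak r$ is *cell-perspective*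 to $\mathfrak s$ if they are opposite sides of $S$. * $\mathfrak r$ *swings* to $\mathfrak s$ if $1_{\mathfrak r}=1_{\mathfrak s}$, this element has at least three lower covers, and $0_{\mathfrak s}$ is neither its leftmost nor its rightmost lower cover. The swing is *strong* if, in addition, $0_{\mathfrak s}$ is an eye whenever $0_{\mathfrak r}$ is an eye. * $\mathfrak r$ *tilts* to $\mathfrak s$ if $0_{\mathfrak r}=0_{\mathfrak s}$, this element has at least three covers, and $1_{\mathfrak s}$ is neither its leftmost nor its rightmost cover. A sequence $\mathfrak r_0,\dots,\mathfrak r_n$ ($n\ge 0$) of prime intervals is an *SL-sequence* from $\mathfrak r_0$ to $\mathfrak r_n$ if, for each $i\in\{1,\dots,n\}$, $\mathfrak r_{i-1}$ is cell-perspective to, or swings to, or tilts to $\mathfrak r_i$. It is an *SSL-sequence* if, for each $i\in\{1,\dots,n\}$, $\mathfrak r_{i-1}$ is cell-perspective to, or tilts to, or strongly swings to $\mathfrak r_i$. Then, for all prime intervals $\mathfrak p,\mathfrak q$ of $L$: 1. if there is an SL-sequence from $\mathfrak p$ to $\mathfrak q$ (in particular, if there is an SSL-sequence from $\mathfrak p$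 to $\mathfrak q$), then $(0_{\mathfrak q},1_{\mathfrak q})\in\mathrm{con}(\mathfrak p)$; 2. conversely, if $(0_{\mathfrak q},1_{\mathfrak q})\in\mathrm{con}(\mathfrak p)$, then there is an SSL-sequence from $\mathfrak p$ to $\mathfrak q$. -/

import Mathlib

/-- A prime interval `[bot, top]` of an order: `bot` is covered by `top`.
These are the edges of the Hasse diagram. -/
@[ext]
structure PrimeInterval (L : Type*) [PartialOrder L] where
  bot : L
  top : L
  covBy : bot ⋖ top

/-- A planar Hasse diagram: the elements are drawn as distinct points of the plane, larger elements
are drawn higher, every covering pair is drawn as a straight line segment, and two different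
segments can meet only in (the point of) a common endpoint. -/
structure PlanarDiagram (L : Type*) [PartialOrder L] where
  pos : L → ℝ × ℝ
  pos_injective : Function.Injective pos
  height_lt : ∀ a b : L, a < b → (pos a).2 < (pos b).2
  noncrossing : ∀ p q : PrimeInterval L, p ≠ q →
    ∀ w ∈ segment ℝ (pos p.bot) (pos p.top), w ∈ segment ℝ (pos q.bot) (pos q.top) →
      ∃ c : L, (c = p.bot ∨ c = p.top) ∧ (c = q.bot ∨ c = q.top) ∧ pos c = w

namespace PlanarDiagram

section Order

variable {L : Type*} [PartialOrder L] (D : PlanarDiagram L)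

/-- The straight line segment joining two elements in the diagram. -/
def seg (a b : L) : Set (ℝ × ℝ) :=
  segment ℝ (D.pos a) (D.pos b)

/-- The edge `[a, b]` is to the left of the edge `[c, d]`, compared at a common height. It is only
used for edges with the same top or with the same bottom, where all heights give the same
answer. -/
def EdgeLeftOf (a b c d : L) : Prop :=
  ∃ v ∈ D.seg a b, ∃ w ∈ D.seg c d, v.2 = w.2 ∧ v.1 < w.1

/-- `a` is the leftmost lower cover of `z`. -/
def IsLeftmostLowerCover (z a : L) : Prop :=
  a ⋖ z ∧ ∀ a' : L, a' ⋖ z → a' ≠ a → D.EdgeLeftOf a z a' z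

/-- `a` is the rightmost lower cover of `z`. -/
def IsRightmostLowerCover (z a : L) : Prop :=
  a ⋖ z ∧ ∀ a' : L, a' ⋖ z → a' ≠ a → D.EdgeLeftOf a' z a z

/-- `b` is the leftmost (upper) cover of `z`. -/
def IsLeftmostCover (z b : L) : Prop :=
  z ⋖ b ∧ ∀ b' : L, z ⋖ b' → b' ≠ b → D.EdgeLeftOf z b z b'

/-- `b` is the rightmost (upper) cover of `z`. -/
def IsRightmostCover (z b : L) : Prop :=
  z ⋖ b ∧ ∀ b' : L, z ⋖ b' → b' ≠ b → D.EdgeLeftOf z b' z b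

/-- `C` is a maximal chain of the interval `[a, b]`. -/
def IsMaxChainIn (a b : L) (C : Set L) : Prop :=
  Maximal (fun X : Set L => X ⊆ Set.Icc a b ∧ IsChain (· ≤ ·) X) C

/-- `z` is on the right of the chain `C`: it lies at, or horizontally to the right of, a point of
the polygonal line formed by the edges of `C`. (The elements of `C` are on both sides of `C`.) -/
def OnRight (C : Set L) (z : L) : Prop :=
  ∃ u ∈ C, ∃ v ∈ C, u ⋖ v ∧ ∃ w ∈ D.seg u v, w.2 = (D.pos z).2 ∧ w.1 ≤ (D.pos z).1

/-- `z` is on the left of the chain `C`. -/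
def OnLeft (C : Set L) (z : L) : Prop :=
  ∃ u ∈ C, ∃ v ∈ C, u ⋖ v ∧ ∃ w ∈ D.seg u v, w.2 = (D.pos z).2 ∧ (D.pos z).1 ≤ w.1

/-- A region of the diagram: all elements of an interval `[a, b]` that are on the right of `C₁` and
on the left of `C₂`, where `C₁` and `C₂` are maximal chains of `[a, b]` that have only `a` and `b`
in common, and `C₂` is on the right of `C₁`. -/
def IsRegion (R : Set L) : Prop :=
  ∃ a b : L, a < b ∧ ¬ a ⋖ b ∧ ∃ C₁ C₂ : Set L,
    IsMaxChainIn a b C₁ ∧ IsMaxChainIn a b C₂ ∧ C₁ ∩ C₂ = {a, b} ∧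
    (∀ z ∈ C₂ \ {a, b}, D.OnRight C₁ z) ∧
    R = {z | z ∈ Set.Icc a b ∧ D.OnRight C₁ z ∧ D.OnLeft C₂ z}

/-- A cell is a minimal region. -/
def IsCell (R : Set L) : Prop :=
  Minimal D.IsRegion R

/-- `{o, u, v, i}` is a 4-cell with bottom `o`, top `i` and two further vertices `u` and `v` (in
either left-right order): a cell formed by four vertices and four edges. -/
def IsFourCell (o u v i : L) : Prop :=
  D.IsCell {o, u, v, i} ∧ u ≠ v ∧ o ⋖ u ∧ o ⋖ v ∧ u ⋖ i ∧ v ⋖ i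

/-- The two prime intervals are sides of the same 4-cell. -/
def SameFourCell (r s : PrimeInterval L) : Prop :=
  ∃ o u v i : L, D.IsFourCell o u v i ∧
    ∀ t : PrimeInterval L, t = r ∨ t = s →
      (t.bot = o ∧ t.top = u) ∨ (t.bot = o ∧ t.top = v) ∨
      (t.bot = u ∧ t.top = i) ∨ (t.bot = v ∧ t.top = i)

/-- `r` and `s` are opposite sides of a 4-cell. As `IsFourCell` is symmetric in the two middle
vertices, this covers both pairs of opposite sides. -/
def CellPerspective (r s : PrimeInterval L) : Prop :=
  ∃ o u v i : L, D.IsFourCell o u v i ∧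
    ((r.bot = o ∧ r.top = u ∧ s.bot = v ∧ s.top = i) ∨
      (r.bot = v ∧ r.top = i ∧ s.bot = o ∧ s.top = u))

/-- `r` swings to `s`. -/
def Swings (r s : PrimeInterval L) : Prop :=
  r ≠ s ∧ D.SameFourCell r s ∧ r.top = s.top ∧ 3 ≤ {a : L | a ⋖ r.top}.ncard ∧
    ¬ D.IsLeftmostLowerCover r.top s.bot ∧ ¬ D.IsRightmostLowerCover r.top s.bot

/-- `r` tilts to `s`. -/
def Tilts (r s : PrimeInterval L) : Prop :=
  r ≠ s ∧ D.SameFourCell r s ∧ r.bot = s.bot ∧ 3 ≤ {b : L | r.bot ⋖ b}.ncard ∧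
    ¬ D.IsLeftmostCover r.bot s.top ∧ ¬ D.IsRightmostCover r.bot s.top

/-- `r 0, …, r n` is an SL-sequence from `p` to `q`. -/
def IsSLSequence (p q : PrimeInterval L) (n : ℕ) (r : Fin (n + 1) → PrimeInterval L) : Prop :=
  r 0 = p ∧ r (Fin.last n) = q ∧ ∀ j : Fin n,
    D.CellPerspective (r j.castSucc) (r j.succ) ∨ D.Swings (r j.castSucc) (r j.succ) ∨
      D.Tilts (r j.castSucc) (r j.succ)

end Order

section Lattice

variable {L : Type*} [Lattice L] (D : PlanarDiagram L)

/-- `x` is an eye: it is doubly irreducible, its (unique) lower cover `o` has at least three covers,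
and `x` is neither the leftmost nor the rightmost cover of `o`. -/
def IsEye (x : L) : Prop :=
  InfIrred x ∧ SupIrred x ∧ ∃ o : L, o ⋖ x ∧ 3 ≤ {b : L | o ⋖ b}.ncard ∧
    ¬ D.IsLeftmostCover o x ∧ ¬ D.IsRightmostCover o x

/-- `r` strongly swings to `s`. -/
def StronglySwings (r s : PrimeInterval L) : Prop :=
  D.Swings r s ∧ (D.IsEye r.bot → D.IsEye s.bot)

/-- `r 0, …, r n` is an SSL-sequence from `p` to `q`. -/
def IsSSLSequence (p q : PrimeInterval L) (n : ℕ) (r : Fin (n + 1) → PrimeInterval L) : Prop :=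
  r 0 = p ∧ r (Fin.last n) = q ∧ ∀ j : Fin n,
    D.CellPerspective (r j.castSucc) (r j.succ) ∨ D.Tilts (r j.castSucc) (r j.succ) ∨
      D.StronglySwings (r j.castSucc) (r j.succ)

end Lattice

end PlanarDiagram

/-- `con(p)`: the intersection of all lattice congruences that collapse `p`. -/
def PrimeInterval.con {L : Type*} [Lattice L] (p : PrimeInterval L) : LatticeCon L where
  r x y := ∀ c : LatticeCon L, c.r p.bot p.top → c.r x y
  iseqv := ⟨fun x c _ => c.refl x, fun h c hc => c.symm (h c hc),
    fun h₁ h₂ c hc => c.trans (h₁ c hc) (h₂ c hc)⟩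
  inf := fun h₁ h₂ c hc => c.inf (h₁ c hc) (h₂ c hc)
  sup := fun h₁ h₂ c hc => c.sup (h₁ c hc) (h₂ c hc)

/-- `con(p)` is the least congruence collapsing `p`. -/
theorem PrimeInterval.con_least {L : Type*} [Lattice L] (p : PrimeInterval L) :
    p.con.r p.bot p.top ∧
      ∀ c : LatticeCon L, c.r p.bot p.top → ∀ x y : L, p.con.r x y → c.r x y :=
  ⟨fun _ hc => hc, fun c hc _ _ h => h c hc⟩

/-! The easy direction rests on planarity. If `b` lies between `a` and `c` among the lower covers of
`x`, then `a ⊓ c ≤ b`: the path leading down from `b` is trapped between paths through `a` and `c`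
and must meet one of them (`inf_le_of_btw`). Dually `b ≤ a ⊔ c` for upper covers (`le_sup_of_btw`).
Hence swings and tilts, like cell-perspectivities, preserve collapsing.

For the converse, consider the set of edges reachable from `p` by SSL-steps. It is closed upwards:
joining a reachable edge with a cover of its bottom gives a reachable edge or collapses it
(`Reach.upper_closed`). It is closed downwards: meeting it with an element below its top gives a
path of reachable edges (`Reach.lower_closed`). A set of edges with these two properties generates a
congruence that collapses no other edge (`edge_of_eqvGen`), so every edge collapsed by `con(p)` is
reachable.

Both closures proceed through neighbouring covers, which span 4-cells. Strong swings suffice because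
a swing away from an eye can be replaced by a perspectivity, a tilt and a perspectivity
(`Reach.swing`). -/

namespace PlanarDiagram

/-- `b` is strictly between `a` and `c` with respect to the values of `f`. -/
def Btw {α : Type*} (f : α → ℝ) (a b c : α) : Prop :=
  (f a < f b ∧ f b < f c) ∨ (f c < f b ∧ f b < f a)

theorem Btw.symm {α : Type*} {f : α → ℝ} {a b c : α} (h : Btw f a b c) : Btw f c b a := Or.symm h

theorem Btw.ne {α : Type*} {f : α → ℝ} {a b c : α} (h : Btw f a b c) : a ≠ b ∧ b ≠ c ∧ a ≠ c := by
  refine ⟨?_, ?_, ?_⟩ <;> rintro rfl <;> rcases h with h | h <;> linarith [h.1, h.2]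

/-! ### Edges as graphs over the height; the left-right order of covers by slope. -/

section Order

variable {L : Type*} [PartialOrder L] (D : PlanarDiagram L)

/-- The slope (horizontal over vertical) of the line through two elements of the diagram. -/
noncomputable def slope (a b : L) : ℝ :=
  ((D.pos b).1 - (D.pos a).1) / ((D.pos b).2 - (D.pos a).2)

/-- The horizontal coordinate, at height `t`, of the line through two elements. -/
noncomputable def lin (a b : L) (t : ℝ) : ℝ :=
  (D.pos a).1 + (t - (D.pos a).2) * D.slope a b

theorem lin_bot (a b : L) : D.lin a b (D.pos a).2 = (D.pos a).1 := by simp [lin]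

theorem lin_eq_top {a b : L} (h : a < b) (t : ℝ) :
    D.lin a b t = (D.pos b).1 - ((D.pos b).2 - t) * D.slope a b := by
  have h1 := D.height_lt a b h
  have h2 : (D.pos b).2 - (D.pos a).2 ≠ 0 := by linarith
  have : ((D.pos b).2 - (D.pos a).2) * D.slope a b = (D.pos b).1 - (D.pos a).1 := by
    rw [slope]; field_simp
  rw [lin]; linarith

theorem lin_top {a b : L} (h : a < b) : D.lin a b (D.pos b).2 = (D.pos b).1 := by
  simp [D.lin_eq_top h]

theorem continuous_lin (a b : L) : Continuous (D.lin a b) := by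
  unfold lin; fun_prop

theorem height_le {a b : L} (h : a ≤ b) : (D.pos a).2 ≤ (D.pos b).2 := by
  rcases h.eq_or_lt with rfl | h
  · rfl
  · exact (D.height_lt _ _ h).le

theorem mem_seg_iff {a b : L} (h : a < b) (w : ℝ × ℝ) :
    w ∈ D.seg a b ↔ (D.pos a).2 ≤ w.2 ∧ w.2 ≤ (D.pos b).2 ∧ w.1 = D.lin a b w.2 := by
  have h1 := D.height_lt a b h
  have h2 : (D.pos b).2 - (D.pos a).2 ≠ 0 := by linarith
  have h3 : 0 < (D.pos b).2 - (D.pos a).2 := by linarith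
  rw [seg, segment_eq_image']
  constructor
  · rintro ⟨θ, ⟨h0, h1'⟩, rfl⟩
    simp only [Prod.fst_add, Prod.snd_add, Prod.smul_fst, Prod.smul_snd, Prod.fst_sub,
      Prod.snd_sub, smul_eq_mul]
    refine ⟨by nlinarith, by nlinarith, ?_⟩
    rw [lin, slope]; field_simp; ring
  · rintro ⟨ha, hb, hw⟩
    refine ⟨(w.2 - (D.pos a).2) / ((D.pos b).2 - (D.pos a).2),
      ⟨by apply div_nonneg <;> linarith, by rw [div_le_one h3]; linarith⟩, ?_⟩
    ext
    · simp only [Prod.fst_add, Prod.smul_fst, Prod.fst_sub, smul_eq_mul]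
      rw [hw, lin, slope]; ring
    · simp only [Prod.snd_add, Prod.smul_snd, Prod.snd_sub, smul_eq_mul]
      field_simp; ring

theorem lin_mem_seg {a b : L} (h : a < b) {t : ℝ} (ha : (D.pos a).2 ≤ t) (hb : t ≤ (D.pos b).2) :
    (D.lin a b t, t) ∈ D.seg a b :=
  (D.mem_seg_iff h _).2 ⟨ha, hb, rfl⟩

/-- Two edges with a common point have a common endpoint at that point, unless they agree. -/
theorem edge_inter {a b c d : L} (h : a ⋖ b) (h' : c ⋖ d) {w : ℝ × ℝ} (hw : w ∈ D.seg a b)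
    (hw' : w ∈ D.seg c d) :
    (a = c ∧ b = d) ∨ ∃ e : L, (e = a ∨ e = b) ∧ (e = c ∨ e = d) ∧ D.pos e = w := by
  by_cases hpq : (⟨a, b, h⟩ : PrimeInterval L) = ⟨c, d, h'⟩
  · simp only [PrimeInterval.mk.injEq] at hpq
    exact Or.inl hpq
  · exact Or.inr (D.noncrossing _ _ hpq w hw hw')

/-- With equal slopes, the higher of the two bottoms would lie on the other edge, so noncrossing
makes it an endpoint of that edge. -/
theorem slope_top_injOn (z : L) : Set.InjOn (fun a => D.slope a z) {a | a ⋖ z} := by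
  have key : ∀ a b : L, a ⋖ z → b ⋖ z → D.slope a z = D.slope b z →
      (D.pos b).2 ≤ (D.pos a).2 → a = b := by
    intro a b ha hb h hab
    have h1 : D.pos a ∈ D.seg a z := left_mem_segment ..
    have h2 : D.pos a ∈ D.seg b z := by
      rw [D.mem_seg_iff hb.lt]
      refine ⟨hab, D.height_le ha.le, ?_⟩
      rw [D.lin_eq_top hb.lt, ← h, ← D.lin_eq_top ha.lt, D.lin_bot]
    rcases D.edge_inter ha hb h1 h2 with h' | ⟨e, -, h', h''⟩
    · exact h'.1
    · obtain rfl := D.pos_injective h''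
      exact h'.resolve_right ha.lt.ne
  intro a ha b hb h
  rcases le_total (D.pos b).2 (D.pos a).2 with h' | h'
  · exact key a b ha hb h h'
  · exact (key b a hb ha h.symm h').symm

theorem slope_bot_injOn (z : L) : Set.InjOn (fun a => D.slope z a) {a | z ⋖ a} := by
  have key : ∀ a b : L, z ⋖ a → z ⋖ b → D.slope z a = D.slope z b →
      (D.pos a).2 ≤ (D.pos b).2 → a = b := by
    intro a b ha hb h hab
    have h1 : D.pos a ∈ D.seg z a := right_mem_segment ..
    have h2 : D.pos a ∈ D.seg z b := by
      rw [D.mem_seg_iff hb.lt]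
      refine ⟨D.height_le ha.le, hab, ?_⟩
      rw [lin, ← h, ← lin, D.lin_top ha.lt]
    rcases D.edge_inter ha hb h1 h2 with h' | ⟨e, -, h', h''⟩
    · exact h'.2
    · obtain rfl := D.pos_injective h''
      exact h'.resolve_left ha.lt.ne'
  intro a ha b hb h
  rcases le_total (D.pos a).2 (D.pos b).2 with h' | h'
  · exact key a b ha hb h h'
  · exact (key b a hb ha h.symm h').symm

/-- The inequality is reversed because positions are measured downwards from the common top: a
larger slope runs further to the left. -/
theorem edgeLeftOf_top_iff {a b z : L} (ha : a ⋖ z) (hb : b ⋖ z) :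
    D.EdgeLeftOf a z b z ↔ D.slope b z < D.slope a z := by
  constructor
  · rintro ⟨v, hv, w, hw, h, hlt⟩
    rw [D.mem_seg_iff ha.lt] at hv
    rw [D.mem_seg_iff hb.lt] at hw
    rw [hv.2.2, hw.2.2, D.lin_eq_top ha.lt, D.lin_eq_top hb.lt, h] at hlt
    have := hw.2.1
    by_contra! hle
    nlinarith
  · intro h
    have h1 := D.height_lt _ _ ha.lt
    have h2 := D.height_lt _ _ hb.lt
    have h3 : max (D.pos a).2 (D.pos b).2 < (D.pos z).2 := max_lt h1 h2
    refine ⟨_, D.lin_mem_seg ha.lt (le_max_left _ _) h3.le, _,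
      D.lin_mem_seg hb.lt (le_max_right _ _) h3.le, rfl, ?_⟩
    simp only [D.lin_eq_top ha.lt, D.lin_eq_top hb.lt]
    nlinarith

theorem edgeLeftOf_bot_iff {a b z : L} (ha : z ⋖ a) (hb : z ⋖ b) :
    D.EdgeLeftOf z a z b ↔ D.slope z a < D.slope z b := by
  constructor
  · rintro ⟨v, hv, w, hw, h, hlt⟩
    rw [D.mem_seg_iff ha.lt] at hv
    rw [D.mem_seg_iff hb.lt] at hw
    rw [hv.2.2, hw.2.2, lin, lin, h] at hlt
    have := hw.1
    by_contra! hle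
    nlinarith
  · intro h
    have h1 := D.height_lt _ _ ha.lt
    have h2 := D.height_lt _ _ hb.lt
    have h3 : (D.pos z).2 < min (D.pos a).2 (D.pos b).2 := lt_min h1 h2
    refine ⟨_, D.lin_mem_seg ha.lt h3.le (min_le_left _ _), _,
      D.lin_mem_seg hb.lt h3.le (min_le_right _ _), rfl, ?_⟩
    simp only [lin]
    nlinarith

/-- There is a cover on each side of `b`; the one on the side away from `a` serves as `c`.
Injectivity of the slope makes the inequalities strict. -/
theorem btw_lower_of_not_extreme {z a b : L} (ha : a ⋖ z) (hb : b ⋖ z) (hab : a ≠ b)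
    (hl : ¬ D.IsLeftmostLowerCover z b) (hr : ¬ D.IsRightmostLowerCover z b) :
    ∃ c, c ⋖ z ∧ Btw (fun w => D.slope w z) a b c := by
  simp only [IsLeftmostLowerCover, IsRightmostLowerCover, not_and, not_forall] at hl hr
  obtain ⟨c, hc, hcb, h⟩ := hl hb
  obtain ⟨d, hd, hdb, h'⟩ := hr hb
  rw [D.edgeLeftOf_top_iff hb hc, not_lt] at h
  rw [D.edgeLeftOf_top_iff hd hb, not_lt] at h'
  have h1 : D.slope a z ≠ D.slope b z := (D.slope_top_injOn z).ne ha hb hab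
  have h2 : D.slope c z ≠ D.slope b z := (D.slope_top_injOn z).ne hc hb hcb
  have h3 : D.slope d z ≠ D.slope b z := (D.slope_top_injOn z).ne hd hb hdb
  rcases h1.lt_or_gt with h1 | h1
  · exact ⟨c, hc, Or.inl ⟨h1, lt_of_le_of_ne h h2.symm⟩⟩
  · exact ⟨d, hd, Or.inr ⟨lt_of_le_of_ne h' h3, h1⟩⟩

theorem btw_upper_of_not_extreme {z a b : L} (ha : z ⋖ a) (hb : z ⋖ b) (hab : a ≠ b)
    (hl : ¬ D.IsLeftmostCover z b) (hr : ¬ D.IsRightmostCover z b) :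
    ∃ c, z ⋖ c ∧ Btw (fun w => D.slope z w) a b c := by
  simp only [IsLeftmostCover, IsRightmostCover, not_and, not_forall] at hl hr
  obtain ⟨c, hc, hcb, h⟩ := hl hb
  obtain ⟨d, hd, hdb, h'⟩ := hr hb
  rw [D.edgeLeftOf_bot_iff hb hc, not_lt] at h
  rw [D.edgeLeftOf_bot_iff hd hb, not_lt] at h'
  have h1 : D.slope z a ≠ D.slope z b := (D.slope_bot_injOn z).ne ha hb hab
  have h2 : D.slope z c ≠ D.slope z b := (D.slope_bot_injOn z).ne hc hb hcb
  have h3 : D.slope z d ≠ D.slope z b := (D.slope_bot_injOn z).ne hd hb hdb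
  rcases h1.lt_or_gt with h1 | h1
  · exact ⟨d, hd, Or.inl ⟨h1, lt_of_le_of_ne h' h3.symm⟩⟩
  · exact ⟨c, hc, Or.inr ⟨lt_of_le_of_ne h h2, h1⟩⟩

theorem not_extreme_lower_of_btw {z a b c : L} (ha : a ⋖ z) (hb : b ⋖ z) (hc : c ⋖ z)
    (h : Btw (fun w => D.slope w z) a b c) :
    ¬ D.IsLeftmostLowerCover z b ∧ ¬ D.IsRightmostLowerCover z b := by
  obtain ⟨hab, hbc, -⟩ := h.ne
  constructor <;> intro h'
  · have h1 := h'.2 a ha hab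
    have h2 := h'.2 c hc hbc.symm
    rw [D.edgeLeftOf_top_iff hb ha] at h1
    rw [D.edgeLeftOf_top_iff hb hc] at h2
    rcases h with h | h <;> linarith [h.1, h.2]
  · have h1 := h'.2 a ha hab
    have h2 := h'.2 c hc hbc.symm
    rw [D.edgeLeftOf_top_iff ha hb] at h1
    rw [D.edgeLeftOf_top_iff hc hb] at h2
    rcases h with h | h <;> linarith [h.1, h.2]

theorem not_extreme_upper_of_btw {z a b c : L} (ha : z ⋖ a) (hb : z ⋖ b) (hc : z ⋖ c)
    (h : Btw (fun w => D.slope z w) a b c) :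
    ¬ D.IsLeftmostCover z b ∧ ¬ D.IsRightmostCover z b := by
  obtain ⟨hab, hbc, -⟩ := h.ne
  constructor <;> intro h'
  · have h1 := h'.2 a ha hab
    have h2 := h'.2 c hc hbc.symm
    rw [D.edgeLeftOf_bot_iff hb ha] at h1
    rw [D.edgeLeftOf_bot_iff hb hc] at h2
    rcases h with h | h <;> linarith [h.1, h.2]
  · have h1 := h'.2 a ha hab
    have h2 := h'.2 c hc hbc.symm
    rw [D.edgeLeftOf_bot_iff ha hb] at h1
    rw [D.edgeLeftOf_bot_iff hc hb] at h2
    rcases h with h | h <;> linarith [h.1, h.2]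

/-! ### Polygonal lines along chains and their intersections. -/

/-- `f` is the polygonal line, as a function of the height, that is formed by edges between elements
of `C` and leads from `a` to `b`. -/
structure IsTrace (C : Set L) (f : ℝ → ℝ) (a b : L) : Prop where
  continuous : Continuous f
  eq_bot : f (D.pos a).2 = (D.pos a).1
  eq_top : f (D.pos b).2 = (D.pos b).1
  edge : ∀ t, (D.pos a).2 ≤ t → t ≤ (D.pos b).2 →
    ∃ u ∈ C, ∃ v ∈ C, u ⋖ v ∧ (f t, t) ∈ D.seg u v

theorem isTrace_lin {a b : L} (h : a ⋖ b) : D.IsTrace {a, b} (D.lin a b) a b where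
  continuous := D.continuous_lin a b
  eq_bot := D.lin_bot a b
  eq_top := D.lin_top h.lt
  edge t ha hb := ⟨a, by simp, b, by simp, h, D.lin_mem_seg h.lt ha hb⟩

variable {D}

theorem IsTrace.append {C C' : Set L} {f g : ℝ → ℝ} {a b c : L} (hf : D.IsTrace C f a b)
    (hg : D.IsTrace C' g b c) (hab : a ≤ b) (hbc : b ≤ c) :
    D.IsTrace (C ∪ C') (fun t => if t ≤ (D.pos b).2 then f t else g t) a c where
  continuous := by
    refine Continuous.if_le hf.continuous hg.continuous continuous_id continuous_const ?_
    intro t ht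
    rw [show t = (D.pos b).2 from ht, hf.eq_top, hg.eq_bot]
  eq_bot := by simp only [D.height_le hab, if_true, hf.eq_bot]
  eq_top := by
    split_ifs with h
    · have := le_antisymm h (D.height_le hbc)
      rw [this, hf.eq_top, ← hg.eq_bot, ← this, hg.eq_top]
    · exact hg.eq_top
  edge t ha hc := by
    by_cases h : t ≤ (D.pos b).2
    · obtain ⟨u, hu, v, hv, huv, hm⟩ := hf.edge t ha h
      exact ⟨u, Or.inl hu, v, Or.inl hv, huv, by simpa only [h, if_true] using hm⟩
    · obtain ⟨u, hu, v, hv, huv, hm⟩ := hg.edge t (le_of_not_ge h) hc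
      exact ⟨u, Or.inr hu, v, Or.inr hv, huv, by simpa only [h, if_false] using hm⟩

theorem IsTrace.mono {C C' : Set L} {f : ℝ → ℝ} {a b : L} (hf : D.IsTrace C f a b) (h : C ⊆ C') :
    D.IsTrace C' f a b where
  continuous := hf.continuous
  eq_bot := hf.eq_bot
  eq_top := hf.eq_top
  edge t ha hb := by
    obtain ⟨u, hu, v, hv, huv, hm⟩ := hf.edge t ha hb
    exact ⟨u, h hu, v, h hv, huv, hm⟩

/-- Two polygonal lines meet only in common elements or along common edges. -/
theorem IsTrace.inter {C C' : Set L} {f g : ℝ → ℝ} {a b a' b' : L} (hf : D.IsTrace C f a b)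
    (hg : D.IsTrace C' g a' b') {t : ℝ} (ha : (D.pos a).2 ≤ t) (hb : t ≤ (D.pos b).2)
    (ha' : (D.pos a').2 ≤ t) (hb' : t ≤ (D.pos b').2) (h : f t = g t) :
    (∃ c ∈ C ∩ C', (D.pos c).2 = t) ∨
      ∃ u ∈ C ∩ C', ∃ v ∈ C ∩ C', u ⋖ v ∧ (D.pos u).2 ≤ t ∧ t ≤ (D.pos v).2 := by
  obtain ⟨u, hu, v, hv, huv, hm⟩ := hf.edge t ha hb
  obtain ⟨u', hu', v', hv', huv', hm'⟩ := hg.edge t ha' hb'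
  rw [← h] at hm'
  rcases D.edge_inter huv huv' hm hm' with ⟨rfl, rfl⟩ | ⟨e, he, he', hp⟩
  · rw [D.mem_seg_iff huv.lt] at hm
    exact Or.inr ⟨u, ⟨hu, hu'⟩, v, ⟨hv, hv'⟩, huv, hm.1, hm.2.1⟩
  · refine Or.inl ⟨e, ⟨?_, ?_⟩, by rw [hp]⟩
    · rcases he with rfl | rfl <;> assumption
    · rcases he' with rfl | rfl <;> assumption

variable (D)

/-- The second conclusion fixes the line near `x`, so that lines through different lower covers of
`x` can be compared by slope there. -/
theorem exists_trace_top [Finite L] {o a x : L} (hoa : o ≤ a) (hax : a ⋖ x) :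
    ∃ f, D.IsTrace (insert x (Set.Icc o a)) f o x ∧
      ∀ t, (D.pos a).2 ≤ t → f t = D.lin a x t := by
  induction o using WellFoundedGT.induction with
  | _ o ih =>
    rcases hoa.eq_or_lt with rfl | h
    · refine ⟨_, (D.isTrace_lin hax).mono ?_, fun _ _ => rfl⟩
      rintro z (rfl | rfl) <;> simp
    · obtain ⟨o', ho, ho'⟩ := exists_covBy_le_of_lt h
      obtain ⟨f, hf, hf'⟩ := ih o' ho.lt ho'
      refine ⟨_, ((D.isTrace_lin ho).append hf ho.le (ho'.trans hax.le)).mono ?_, ?_⟩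
      · rintro z ((rfl | rfl) | (rfl | h))
        · simp [hoa]
        · simp [ho.le, ho']
        · simp
        · exact Or.inr ⟨ho.le.trans h.1, h.2⟩
      · intro t ht
        split_ifs with h
        · have h1 := le_antisymm h ((D.height_le ho').trans ht)
          rw [← hf' t ht, h1, D.lin_top ho.lt, hf.eq_bot]
        · exact hf' t ht

theorem exists_trace_bot [Finite L] {o a x : L} (hoa : o ⋖ a) (hax : a ≤ x) :
    ∃ f, D.IsTrace (insert o (Set.Icc a x)) f o x ∧
      ∀ t, t ≤ (D.pos a).2 → f t = D.lin o a t := by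
  induction x using WellFoundedLT.induction with
  | _ x ih =>
    rcases hax.eq_or_lt with rfl | h
    · refine ⟨_, (D.isTrace_lin hoa).mono ?_, fun _ _ => rfl⟩
      rintro z (rfl | rfl) <;> simp
    · obtain ⟨x', hx', hx⟩ := exists_le_covBy_of_lt h
      obtain ⟨f, hf, hf'⟩ := ih x' hx.lt hx'
      refine ⟨_, (hf.append (D.isTrace_lin hx) (hoa.le.trans hx') hx.le).mono ?_, ?_⟩
      · rintro z ((rfl | h) | (rfl | rfl))
        · simp
        · exact Or.inr ⟨h.1, h.2.trans hx.le⟩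
        · simp [hx.le, hx']
        · simp [hax]
      · intro t ht
        rw [if_pos (ht.trans (D.height_le hx'))]
        exact hf' t ht

/-- Lines that meet strictly below `x` share an element other than `x` (for a shared edge, its
bottom). This element is above `o` and below `a'`. -/
theorem common_of_trace_top_eq {o o' a a' x : L} {f g : ℝ → ℝ}
    (hf : D.IsTrace (insert x (Set.Icc o a)) f o x)
    (hg : D.IsTrace (insert x (Set.Icc o' a')) g o' x) {t : ℝ} (ho : (D.pos o).2 ≤ t)
    (ho' : (D.pos o').2 ≤ t) (ht : t < (D.pos x).2) (h : f t = g t) : o ≤ a' := by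
  have key : ∀ c ∈ insert x (Set.Icc o a) ∩ insert x (Set.Icc o' a'), (D.pos c).2 ≤ t →
      o ≤ a' := by
    rintro c ⟨h1, h2⟩ hc
    have hcx : c ≠ x := by rintro rfl; linarith
    exact (h1.resolve_left hcx).1.trans (h2.resolve_left hcx).2
  rcases hf.inter hg ho ht.le ho' ht.le h with ⟨c, hc, hct⟩ | ⟨u, hu, -, -, -, hut, -⟩
  · exact key c hc hct.le
  · exact key u hu hut

theorem common_of_trace_bot_eq {o a a' x x' : L} {f g : ℝ → ℝ}
    (hf : D.IsTrace (insert o (Set.Icc a x)) f o x)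
    (hg : D.IsTrace (insert o (Set.Icc a' x')) g o x') {t : ℝ} (ho : t ≤ (D.pos x).2)
    (ho' : t ≤ (D.pos x').2) (ht : (D.pos o).2 < t) (h : f t = g t) : a' ≤ x := by
  have key : ∀ c ∈ insert o (Set.Icc a x) ∩ insert o (Set.Icc a' x'), t ≤ (D.pos c).2 →
      a' ≤ x := by
    rintro c ⟨h1, h2⟩ hc
    have hcx : c ≠ o := by rintro rfl; linarith
    exact (h2.resolve_left hcx).1.trans (h1.resolve_left hcx).2
  rcases hf.inter hg ht.le ho ht.le ho' h with ⟨c, hc, hct⟩ | ⟨-, -, v, hv, -, -, hvt⟩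
  · exact key c hc hct.ge
  · exact key v hv hvt

end Order

/-! ### The lattice inequalities forced by planarity. -/

section Lattice

variable {L : Type*} [Lattice L] [Finite L] (D : PlanarDiagram L)

/-- Just below `x` the line through `b` runs between those through `a` and `c`. At the height of `a
⊓ c` these two coincide, so by the intermediate value theorem the middle line has met one of them,
at or above that height and below `x`. -/
theorem inf_le_of_btw {a b c x : L} (ha : a ⋖ x) (hb : b ⋖ x) (hc : c ⋖ x)
    (h : Btw (fun w => D.slope w x) a b c) : a ⊓ c ≤ b := by
  wlog hac : D.slope c x < D.slope b x ∧ D.slope b x < D.slope a x generalizing a c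
  · rw [inf_comm]
    exact this hc ha h.symm (h.resolve_right hac)
  obtain ⟨f, hf, hf'⟩ := D.exists_trace_top (inf_le_left : a ⊓ c ≤ a) ha
  obtain ⟨k, hk, hk'⟩ := D.exists_trace_top (inf_le_right : a ⊓ c ≤ c) hc
  -- Starting at `b ⊓ (a ⊓ c)` ensures that this line reaches down to the height of `a ⊓ c`.
  obtain ⟨g, hg, hg'⟩ := D.exists_trace_top (inf_le_left : b ⊓ (a ⊓ c) ≤ b) hb
  set s := (D.pos (a ⊓ c)).2 with hs
  -- From this height up to `x`, all three lines run along their last edges.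
  set t := max (max (D.pos a).2 (D.pos b).2) (D.pos c).2 with ht
  have hat : (D.pos a).2 ≤ t := le_max_of_le_left (le_max_left _ _)
  have hbt : (D.pos b).2 ≤ t := le_max_of_le_left (le_max_right _ _)
  have hct : (D.pos c).2 ≤ t := le_max_right _ _
  have htx : t < (D.pos x).2 :=
    max_lt (max_lt (D.height_lt _ _ ha.lt) (D.height_lt _ _ hb.lt)) (D.height_lt _ _ hc.lt)
  have hst : s ≤ t := (D.height_le inf_le_left).trans hat
  have hos : (D.pos (b ⊓ (a ⊓ c))).2 ≤ s := D.height_le inf_le_right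
  have hfg : f t ≤ g t := by
    rw [hf' t hat, hg' t hbt, D.lin_eq_top ha.lt, D.lin_eq_top hb.lt]
    nlinarith [hac.2]
  have hgk : g t ≤ k t := by
    rw [hk' t hct, hg' t hbt, D.lin_eq_top hc.lt, D.lin_eq_top hb.lt]
    nlinarith [hac.1]
  have hfk : f s = k s := by rw [hf.eq_bot, hk.eq_bot]
  rcases le_total (g s) (f s) with hgs | hgs
  · obtain ⟨τ, hτ, he⟩ := isPreconnected_Icc.intermediate_value₂ (Set.right_mem_Icc.2 hst)
      (Set.left_mem_Icc.2 hst) hf.continuous.continuousOn hg.continuous.continuousOn hfg hgs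
    exact D.common_of_trace_top_eq hf hg hτ.1 (hos.trans hτ.1) (hτ.2.trans_lt htx) he
  · rw [hfk] at hgs
    obtain ⟨τ, hτ, he⟩ := isPreconnected_Icc.intermediate_value₂ (Set.left_mem_Icc.2 hst)
      (Set.right_mem_Icc.2 hst) hk.continuous.continuousOn hg.continuous.continuousOn hgs hgk
    exact D.common_of_trace_top_eq hk hg hτ.1 (hos.trans hτ.1) (hτ.2.trans_lt htx) he

theorem le_sup_of_btw {a b c x : L} (ha : x ⋖ a) (hb : x ⋖ b) (hc : x ⋖ c)
    (h : Btw (fun w => D.slope x w) a b c) : b ≤ a ⊔ c := by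
  wlog hac : D.slope x a < D.slope x b ∧ D.slope x b < D.slope x c generalizing a c
  · rw [sup_comm]
    exact this hc ha h.symm (h.resolve_left hac)
  obtain ⟨f, hf, hf'⟩ := D.exists_trace_bot ha (le_sup_left : a ≤ a ⊔ c)
  obtain ⟨k, hk, hk'⟩ := D.exists_trace_bot hc (le_sup_right : c ≤ a ⊔ c)
  obtain ⟨g, hg, hg'⟩ := D.exists_trace_bot hb (le_sup_left : b ≤ b ⊔ (a ⊔ c))
  set s := (D.pos (a ⊔ c)).2 with hs
  set t := min (min (D.pos a).2 (D.pos b).2) (D.pos c).2 with ht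
  have hat : t ≤ (D.pos a).2 := min_le_of_left_le (min_le_left _ _)
  have hbt : t ≤ (D.pos b).2 := min_le_of_left_le (min_le_right _ _)
  have hct : t ≤ (D.pos c).2 := min_le_right _ _
  have htx : (D.pos x).2 < t :=
    lt_min (lt_min (D.height_lt _ _ ha.lt) (D.height_lt _ _ hb.lt)) (D.height_lt _ _ hc.lt)
  have hst : t ≤ s := hat.trans (D.height_le le_sup_left)
  have hos : s ≤ (D.pos (b ⊔ (a ⊔ c))).2 := D.height_le le_sup_right
  have hfg : f t ≤ g t := by
    rw [hf' t hat, hg' t hbt, lin, lin]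
    nlinarith [hac.1]
  have hgk : g t ≤ k t := by
    rw [hk' t hct, hg' t hbt, lin, lin]
    nlinarith [hac.2]
  have hfk : f s = k s := by rw [hf.eq_top, hk.eq_top]
  rcases le_total (g s) (f s) with hgs | hgs
  · obtain ⟨τ, hτ, he⟩ := isPreconnected_Icc.intermediate_value₂ (Set.left_mem_Icc.2 hst)
      (Set.right_mem_Icc.2 hst) hf.continuous.continuousOn hg.continuous.continuousOn hfg hgs
    exact D.common_of_trace_bot_eq hf hg hτ.2 (hτ.2.trans hos) (htx.trans_le hτ.1) he
  · rw [hfk] at hgs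
    obtain ⟨τ, hτ, he⟩ := isPreconnected_Icc.intermediate_value₂ (Set.right_mem_Icc.2 hst)
      (Set.left_mem_Icc.2 hst) hk.continuous.continuousOn hg.continuous.continuousOn hgs hgk
    exact D.common_of_trace_bot_eq hk hg hτ.2 (hτ.2.trans hos) (htx.trans_le hτ.1) he

end Lattice

end PlanarDiagram

/-! ### 4-cells in intervals of length two. -/

namespace PlanarDiagram

section Order

variable {L : Type*} [PartialOrder L] (D : PlanarDiagram L)

/-- The polygonal line formed by the two edges of the chain `o < u < i`. -/
noncomputable def bent (o u i : L) (t : ℝ) : ℝ :=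
  if t ≤ (D.pos u).2 then D.lin o u t else D.lin u i t

variable {D} {o u w i : L}

theorem bent_of_le {t : ℝ} (h : t ≤ (D.pos u).2) : D.bent o u i t = D.lin o u t := if_pos h

theorem bent_of_ge (hou : o ⋖ u) {t : ℝ} (h : (D.pos u).2 ≤ t) :
    D.bent o u i t = D.lin u i t := by
  rcases h.eq_or_lt with rfl | h
  · rw [bent_of_le le_rfl, D.lin_top hou.lt, D.lin_bot]
  · exact if_neg h.not_ge

theorem bent_self (hou : o ⋖ u) : D.bent o u i (D.pos u).2 = (D.pos u).1 := by
  rw [bent_of_le le_rfl, D.lin_top hou.lt]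

theorem isTrace_bent (hou : o ⋖ u) (hui : u ⋖ i) :
    D.IsTrace ({o, u} ∪ {u, i}) (D.bent o u i) o i :=
  (D.isTrace_lin hou).append (D.isTrace_lin hui) hou.le hui.le

theorem covBy_cases (hou : o ⋖ u) (hui : u ⋖ i) {p q : L} (hp : p ∈ ({o, u, i} : Set L))
    (hq : q ∈ ({o, u, i} : Set L)) (hpq : p ⋖ q) : (p = o ∧ q = u) ∨ (p = u ∧ q = i) := by
  rcases hp with rfl | rfl | rfl <;> rcases hq with rfl | rfl | rfl
  · exact absurd rfl hpq.ne
  · simp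
  · exact absurd hui.lt (hpq.2 hou.lt)
  · exact absurd hpq.lt hou.lt.asymm
  · exact absurd rfl hpq.ne
  · simp
  · exact absurd hpq.lt (hou.lt.trans hui.lt).asymm
  · exact absurd hpq.lt hui.lt.asymm
  · exact absurd rfl hpq.ne

theorem mem_edge_bent_iff (hou : o ⋖ u) (hui : u ⋖ i) (w : ℝ × ℝ) :
    (∃ p ∈ ({o, u, i} : Set L), ∃ q ∈ ({o, u, i} : Set L), p ⋖ q ∧ w ∈ D.seg p q) ↔
      (D.pos o).2 ≤ w.2 ∧ w.2 ≤ (D.pos i).2 ∧ w.1 = D.bent o u i w.2 := by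
  have h1 := D.height_lt _ _ hou.lt
  have h2 := D.height_lt _ _ hui.lt
  constructor
  · rintro ⟨p, hp, q, hq, hpq, hw⟩
    rw [D.mem_seg_iff hpq.lt] at hw
    rcases covBy_cases hou hui hp hq hpq with ⟨rfl, rfl⟩ | ⟨rfl, rfl⟩
    · rw [bent_of_le hw.2.1]
      exact ⟨hw.1, hw.2.1.trans h2.le, hw.2.2⟩
    · rw [bent_of_ge hou hw.1]
      exact ⟨h1.le.trans hw.1, hw.2.1, hw.2.2⟩
  · rintro ⟨ho, hi, hw⟩
    rcases le_total w.2 (D.pos u).2 with h | h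
    · rw [bent_of_le h] at hw
      exact ⟨o, by simp, u, by simp, hou, (D.mem_seg_iff hou.lt _).2 ⟨ho, h, hw⟩⟩
    · rw [bent_of_ge hou h] at hw
      exact ⟨u, by simp, i, by simp, hui, (D.mem_seg_iff hui.lt _).2 ⟨h, hi, hw⟩⟩

theorem onRight_iff (hou : o ⋖ u) (hui : u ⋖ i) (z : L) :
    D.OnRight {o, u, i} z ↔
      (D.pos o).2 ≤ (D.pos z).2 ∧ (D.pos z).2 ≤ (D.pos i).2 ∧
        D.bent o u i (D.pos z).2 ≤ (D.pos z).1 := by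
  constructor
  · rintro ⟨p, hp, q, hq, hpq, w, hw, hwz, hle⟩
    obtain ⟨h1, h2, h3⟩ := (mem_edge_bent_iff hou hui w).1 ⟨p, hp, q, hq, hpq, hw⟩
    rw [← hwz, ← h3]
    exact ⟨h1, h2, hle⟩
  · rintro ⟨h1, h2, h3⟩
    obtain ⟨p, hp, q, hq, hpq, hw⟩ :=
      (mem_edge_bent_iff hou hui (D.bent o u i (D.pos z).2, (D.pos z).2)).2 ⟨h1, h2, rfl⟩
    exact ⟨p, hp, q, hq, hpq, _, hw, rfl, h3⟩

theorem onLeft_iff (hou : o ⋖ u) (hui : u ⋖ i) (z : L) :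
    D.OnLeft {o, u, i} z ↔
      (D.pos o).2 ≤ (D.pos z).2 ∧ (D.pos z).2 ≤ (D.pos i).2 ∧
        (D.pos z).1 ≤ D.bent o u i (D.pos z).2 := by
  constructor
  · rintro ⟨p, hp, q, hq, hpq, w, hw, hwz, hle⟩
    obtain ⟨h1, h2, h3⟩ := (mem_edge_bent_iff hou hui w).1 ⟨p, hp, q, hq, hpq, hw⟩
    rw [← hwz, ← h3]
    exact ⟨h1, h2, hle⟩
  · rintro ⟨h1, h2, h3⟩
    obtain ⟨p, hp, q, hq, hpq, hw⟩ :=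
      (mem_edge_bent_iff hou hui (D.bent o u i (D.pos z).2, (D.pos z).2)).2 ⟨h1, h2, rfl⟩
    exact ⟨p, hp, q, hq, hpq, _, hw, rfl, h3⟩

/-- The two chains share only `o` and `i`, which do not form an edge. -/
theorem bent_ne (hou : o ⋖ u) (hui : u ⋖ i) (how : o ⋖ w) (hwi : w ⋖ i) (huw : u ≠ w) {t : ℝ}
    (ht : t ∈ Set.Ioo (D.pos o).2 (D.pos i).2) : D.bent o u i t ≠ D.bent o w i t := by
  intro h
  have key : ∀ c ∈ (({o, u} ∪ {u, i}) ∩ ({o, w} ∪ {w, i}) : Set L), c = o ∨ c = i := by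
    rintro c ⟨h1, h2⟩
    simp only [Set.mem_union, Set.mem_insert_iff, Set.mem_singleton_iff] at h1 h2
    grind
  rcases (isTrace_bent hou hui).inter (isTrace_bent how hwi) ht.1.le ht.2.le ht.1.le ht.2.le h with
    ⟨c, hc, rfl⟩ | ⟨p, hp, q, hq, hpq, -, -⟩
  · rcases key c hc with rfl | rfl
    · exact lt_irrefl _ ht.1
    · exact lt_irrefl _ ht.2
  · rcases key p hp with rfl | rfl <;> rcases key q hq with rfl | rfl
    · exact hpq.ne rfl
    · exact hpq.2 hou.lt hui.lt
    · exact hpq.lt.asymm (hou.lt.trans hui.lt)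
    · exact hpq.ne rfl

/-- The chain `o < u < i` is drawn on the left of the chain `o < w < i`. -/
def LeftIn (D : PlanarDiagram L) (o i u w : L) : Prop :=
  ∀ t ∈ Set.Ioo (D.pos o).2 (D.pos i).2, D.bent o u i t < D.bent o w i t

theorem leftIn_total (hou : o ⋖ u) (hui : u ⋖ i) (how : o ⋖ w) (hwi : w ⋖ i) (huw : u ≠ w) :
    D.LeftIn o i u w ∨ D.LeftIn o i w u := by
  by_contra! h
  simp only [LeftIn, not_forall, not_lt] at h
  obtain ⟨⟨s, hs, h1⟩, ⟨t, ht, h2⟩⟩ := h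
  obtain ⟨τ, hτ, he⟩ := isPreconnected_Ioo.intermediate_value₂ hs ht
    (isTrace_bent how hwi).continuous.continuousOn
    (isTrace_bent hou hui).continuous.continuousOn h1 h2
  exact bent_ne hou hui how hwi huw hτ he.symm

theorem mem_Ioo_of_covBy (hou : o ⋖ u) (hui : u ⋖ i) :
    (D.pos u).2 ∈ Set.Ioo (D.pos o).2 (D.pos i).2 :=
  ⟨D.height_lt _ _ hou.lt, D.height_lt _ _ hui.lt⟩

/-- At the height of the lower of `u` and `w`, both lines are still on their bottom edges. -/
theorem LeftIn.slope_bot_lt (h : D.LeftIn o i u w) (hou : o ⋖ u) (hui : u ⋖ i) (how : o ⋖ w)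
    (hwi : w ⋖ i) : D.slope o u < D.slope o w := by
  have h1 := mem_Ioo_of_covBy (D := D) hou hui
  have h2 := mem_Ioo_of_covBy (D := D) how hwi
  have h3 : (D.pos o).2 < min (D.pos u).2 (D.pos w).2 := lt_min h1.1 h2.1
  have h4 := h (min (D.pos u).2 (D.pos w).2) ⟨h3, min_lt_of_left_lt h1.2⟩
  rw [bent_of_le (min_le_left _ _), bent_of_le (min_le_right _ _), lin, lin] at h4
  by_contra! hle
  nlinarith

theorem LeftIn.slope_top_lt (h : D.LeftIn o i u w) (hou : o ⋖ u) (hui : u ⋖ i) (how : o ⋖ w)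
    (hwi : w ⋖ i) : D.slope w i < D.slope u i := by
  have h1 := mem_Ioo_of_covBy (D := D) hou hui
  have h2 := mem_Ioo_of_covBy (D := D) how hwi
  have h3 : max (D.pos u).2 (D.pos w).2 < (D.pos i).2 := max_lt h1.2 h2.2
  have h4 := h (max (D.pos u).2 (D.pos w).2) ⟨lt_max_of_lt_left h1.1, h3⟩
  rw [bent_of_ge hou (le_max_left _ _), bent_of_ge how (le_max_right _ _), D.lin_eq_top hui.lt,
    D.lin_eq_top hwi.lt] at h4
  by_contra! hle
  nlinarith

/-- By `leftIn_total`, the comparison at the single height of `w` decides all heights. -/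
theorem onRight_iff_leftIn (hou : o ⋖ u) (hui : u ⋖ i) (how : o ⋖ w) (hwi : w ⋖ i)
    (huw : u ≠ w) : D.OnRight {o, u, i} w ↔ D.LeftIn o i u w := by
  have hw := mem_Ioo_of_covBy (D := D) how hwi
  rw [onRight_iff hou hui]
  constructor
  · rintro ⟨-, -, h⟩
    refine (leftIn_total hou hui how hwi huw).resolve_right fun h' => ?_
    have := h' _ hw
    rw [bent_self how] at this
    exact this.not_ge h
  · intro h
    have := h _ hw
    rw [bent_self how] at this
    exact ⟨hw.1.le, hw.2.le, this.le⟩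

theorem onLeft_iff_leftIn (hou : o ⋖ u) (hui : u ⋖ i) (how : o ⋖ w) (hwi : w ⋖ i)
    (huw : u ≠ w) : D.OnLeft {o, w, i} u ↔ D.LeftIn o i u w := by
  have hw := mem_Ioo_of_covBy (D := D) hou hui
  rw [onLeft_iff how hwi]
  constructor
  · rintro ⟨-, -, h⟩
    refine (leftIn_total hou hui how hwi huw).resolve_right fun h' => ?_
    have := h' _ hw
    rw [bent_self hou] at this
    exact this.not_ge h
  · intro h
    have := h _ hw
    rw [bent_self hou] at this
    exact ⟨hw.1.le, hw.2.le, this.le⟩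

theorem onRight_self (hou : o ⋖ u) (hui : u ⋖ i) {z : L} (hz : z ∈ ({o, u, i} : Set L)) :
    D.OnRight {o, u, i} z := by
  rcases hz with rfl | rfl | rfl
  · exact ⟨z, by simp, u, by simp, hou, _, left_mem_segment .., rfl, le_rfl⟩
  · exact ⟨z, by simp, i, by simp, hui, _, left_mem_segment .., rfl, le_rfl⟩
  · exact ⟨u, by simp, z, by simp, hui, _, right_mem_segment .., rfl, le_rfl⟩

theorem onLeft_self (hou : o ⋖ u) (hui : u ⋖ i) {z : L} (hz : z ∈ ({o, u, i} : Set L)) :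
    D.OnLeft {o, u, i} z := by
  rcases hz with rfl | rfl | rfl
  · exact ⟨z, by simp, u, by simp, hou, _, left_mem_segment .., rfl, le_rfl⟩
  · exact ⟨z, by simp, i, by simp, hui, _, left_mem_segment .., rfl, le_rfl⟩
  · exact ⟨u, by simp, z, by simp, hui, _, right_mem_segment .., rfl, le_rfl⟩

theorem IsMaxChainIn.mem {a b : L} {C : Set L} (hC : IsMaxChainIn a b C) {z : L}
    (hz : z ∈ Set.Icc a b) (h : ∀ c ∈ C, z ≤ c ∨ c ≤ z) : z ∈ C := by
  have : insert z C ⊆ C := hC.2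
    ⟨Set.insert_subset hz hC.1.1, hC.1.2.insert fun c hc _ => h c hc⟩ (Set.subset_insert z C)
  exact this (Set.mem_insert z C)

theorem IsMaxChainIn.exists_covBy [Finite L] {a b : L} {C : Set L} (hC : IsMaxChainIn a b C)
    {z : L} (hz : z ∈ C) (hzb : z ≠ b) : ∃ z' ∈ C, z ⋖ z' := by
  have hzI := hC.1.1 hz
  have hb : b ∈ C := hC.mem ⟨hzI.1.trans hzI.2, le_rfl⟩ fun c hc => Or.inr (hC.1.1 hc).2
  obtain ⟨m, hm⟩ := Set.Finite.exists_minimal (Set.toFinite {c | c ∈ C ∧ z < c})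
    ⟨b, hb, lt_of_le_of_ne hzI.2 hzb⟩
  refine ⟨m, hm.1.1, hm.1.2, fun y hzy hym => ?_⟩
  have hyC : y ∈ C := by
    refine hC.mem ⟨hzI.1.trans hzy.le, hym.le.trans (hC.1.1 hm.1.1).2⟩ fun c hc => ?_
    rcases hC.1.2.total hc hz with h | h
    · exact Or.inr (h.trans hzy.le)
    rcases h.eq_or_lt with rfl | h
    · exact Or.inr hzy.le
    rcases hC.1.2.total hc hm.1.1 with h' | h'
    · exact Or.inl (hym.le.trans (hm.2 ⟨hc, h⟩ h'))
    · exact Or.inl (hym.le.trans h')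
  exact hym.not_ge (hm.2 ⟨hyC, hzy⟩ hym.le)

theorem IsMaxChainIn.exists_edges [Finite L] {a b : L} {C : Set L} (hC : IsMaxChainIn a b C)
    (hab : a < b) : a ∈ C ∧ b ∈ C ∧ (∃ c ∈ C, a ⋖ c) ∧ ∃ c ∈ C, c ⋖ b := by
  have ha : a ∈ C := hC.mem ⟨le_rfl, hab.le⟩ fun c hc => Or.inl (hC.1.1 hc).1
  have hb : b ∈ C := hC.mem ⟨hab.le, le_rfl⟩ fun c hc => Or.inr (hC.1.1 hc).2
  refine ⟨ha, hb, hC.exists_covBy ha hab.ne, ?_⟩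
  obtain ⟨m, hm⟩ := Set.Finite.exists_maximal (Set.toFinite {c | c ∈ C ∧ c < b}) ⟨a, ha, hab⟩
  obtain ⟨z, hz, hmz⟩ := hC.exists_covBy hm.1.1 hm.1.2.ne
  refine ⟨m, hm.1.1, ?_⟩
  rcases (hC.1.1 hz).2.eq_or_lt with rfl | h
  · exact hmz
  · exact absurd (hm.2 ⟨hz, h⟩ hmz.le) hmz.lt.not_ge

theorem isChain_triple {o u i : L} (hou : o ≤ u) (hui : u ≤ i) :
    IsChain (· ≤ ·) ({o, u, i} : Set L) := by
  rintro x (rfl | rfl | rfl) y (rfl | rfl | rfl) - <;> simp [*, hou.trans hui]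

theorem isMaxChainIn_triple (hou : o ⋖ u) (hui : u ⋖ i) : IsMaxChainIn o i {o, u, i} := by
  refine ⟨⟨?_, isChain_triple hou.le hui.le⟩, ?_⟩
  · rintro z (rfl | rfl | rfl)
    · exact ⟨le_rfl, hou.le.trans hui.le⟩
    · exact ⟨hou.le, hui.le⟩
    · exact ⟨hou.le.trans hui.le, le_rfl⟩
  · rintro C ⟨hC, hch⟩ hle z hz
    have hz' := hC hz
    rcases hch.total hz (hle (by simp : u ∈ ({o, u, i} : Set L))) with h | h
    · rcases hou.eq_or_eq hz'.1 h with rfl | rfl <;> simp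
    · rcases hui.eq_or_eq h hz'.2 with rfl | rfl <;> simp

/-- The element `u` only serves to show that `{o, i}` is not a maximal chain, so `C` has an inner
element. -/
theorem IsMaxChainIn.eq_triple {C : Set L} (hC : IsMaxChainIn o i C)
    (hI : ∀ z ∈ Set.Icc o i, z = o ∨ z = i ∨ (o ⋖ z ∧ z ⋖ i)) (hou : o ⋖ u) (hui : u ⋖ i) :
    ∃ w, o ⋖ w ∧ w ⋖ i ∧ C = {o, w, i} := by
  obtain ⟨w, hw, hwo, hwi⟩ : ∃ w ∈ C, w ≠ o ∧ w ≠ i := by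
    by_contra! h
    have h1 : C ⊆ {o, u, i} := fun z hz => by
      by_cases hz' : z = o
      · simp [hz']
      · simp [h z hz hz']
    have h2 := hC.2 (isMaxChainIn_triple hou hui).1 h1 (by simp : u ∈ ({o, u, i} : Set L))
    exact hui.ne (h u h2 hou.ne')
  obtain ⟨how, hwi⟩ : o ⋖ w ∧ w ⋖ i := by
    rcases hI w (hC.1.1 hw) with h | h | h
    · exact absurd h hwo
    · exact absurd h hwi
    · exact h
  refine ⟨w, how, hwi, subset_antisymm ?_ (hC.2 (isMaxChainIn_triple how hwi).1 ?_)⟩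
  all_goals
    intro z hz
    have hz' := hC.1.1 hz
    rcases hC.1.2.total hz hw with h | h
    · rcases how.eq_or_eq hz'.1 h with rfl | rfl <;> simp
    · rcases hwi.eq_or_eq h hz'.2 with rfl | rfl <;> simp

/-- If an interval has length two, then the elements `o < u, v < i` form a cell provided that
no element of the interval is drawn between `u` and `v`. -/
theorem isCell_of_leftIn [Finite L] {v : L}
    (hI : ∀ z ∈ Set.Icc o i, z = o ∨ z = i ∨ (o ⋖ z ∧ z ⋖ i)) (hou : o ⋖ u) (hui : u ⋖ i)
    (hov : o ⋖ v) (hvi : v ⋖ i) (huv : u ≠ v) (hl : D.LeftIn o i u v)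
    (hadj : ∀ w, o ⋖ w → w ⋖ i → D.LeftIn o i u w → D.LeftIn o i w v → False) :
    D.IsCell {o, u, v, i} := by
  have hoi : o < i := hou.lt.trans hui.lt
  refine ⟨⟨o, i, hoi, fun h => h.2 hou.lt hui.lt, {o, u, i}, {o, v, i},
    isMaxChainIn_triple hou hui, isMaxChainIn_triple hov hvi, ?_, ?_, ?_⟩, ?_⟩
  · ext z
    constructor
    · rintro ⟨rfl | rfl | rfl, h⟩
      · simp
      · rcases h with rfl | h | h
        · simp
        · exact absurd h huv
        · exact Or.inr h
      · simp
    · rintro (rfl | rfl) <;> simp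
  · rintro z ⟨rfl | rfl | rfl, hz⟩
    · simp at hz
    · exact (onRight_iff_leftIn hou hui hov hvi huv).2 hl
    · simp at hz
  · ext z
    constructor
    · rintro (rfl | rfl | rfl | rfl)
      · exact ⟨⟨le_rfl, hoi.le⟩, onRight_self hou hui (by simp), onLeft_self hov hvi (by simp)⟩
      · exact ⟨⟨hou.le, hui.le⟩, onRight_self hou hui (by simp),
          (onLeft_iff_leftIn hou hui hov hvi huv).2 hl⟩
      · exact ⟨⟨hov.le, hvi.le⟩, (onRight_iff_leftIn hou hui hov hvi huv).2 hl,
          onLeft_self hov hvi (by simp)⟩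
      · exact ⟨⟨hoi.le, le_rfl⟩, onRight_self hou hui (by simp), onLeft_self hov hvi (by simp)⟩
    · rintro ⟨hz, hr, hl'⟩
      rcases hI z hz with rfl | rfl | ⟨h1, h2⟩
      · simp
      · simp
      by_cases hzu : z = u
      · simp [hzu]
      by_cases hzv : z = v
      · simp [hzv]
      exact (hadj z h1 h2 ((onRight_iff_leftIn hou hui h1 h2 (Ne.symm hzu)).1 hr)
        ((onLeft_iff_leftIn h1 h2 hov hvi hzv).1 hl')).elim
  · rintro R' ⟨a, b, hab, hnab, C₁, C₂, h₁, h₂, hinter, hright, rfl⟩ hle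
    obtain ⟨ha₁, hb₁, ⟨c₁, hc₁, hac₁⟩, ⟨d₁, hd₁, hdb₁⟩⟩ := h₁.exists_edges hab
    obtain ⟨ha₂, hb₂, ⟨c₂, hc₂, hac₂⟩, ⟨d₂, hd₂, hdb₂⟩⟩ := h₂.exists_edges hab
    have haR : a ∈ ({o, u, v, i} : Set L) := hle ⟨⟨le_rfl, hab.le⟩,
      ⟨a, ha₁, c₁, hc₁, hac₁, _, left_mem_segment .., rfl, le_rfl⟩,
      ⟨a, ha₂, c₂, hc₂, hac₂, _, left_mem_segment .., rfl, le_rfl⟩⟩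
    have hbR : b ∈ ({o, u, v, i} : Set L) := hle ⟨⟨hab.le, le_rfl⟩,
      ⟨d₁, hd₁, b, hb₁, hdb₁, _, right_mem_segment .., rfl, le_rfl⟩,
      ⟨d₂, hd₂, b, hb₂, hdb₂, _, right_mem_segment .., rfl, le_rfl⟩⟩
    -- Minimality: a smaller region has its ends among the four vertices, where `o < i` is the only
    -- comparable pair that is not an edge.
    obtain ⟨rfl, rfl⟩ : a = o ∧ b = i := by
      have huv' : ¬ u < v := fun h => hov.2 hou.lt h
      have hvu' : ¬ v < u := fun h => hou.2 hov.lt h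
      rcases haR with rfl | rfl | rfl | rfl <;> rcases hbR with rfl | rfl | rfl | rfl
      · exact absurd hab (lt_irrefl _)
      · exact absurd hou hnab
      · exact absurd hov hnab
      · simp
      · exact absurd hab hou.lt.asymm
      · exact absurd hab (lt_irrefl _)
      · exact absurd hab huv'
      · exact absurd hui hnab
      · exact absurd hab hov.lt.asymm
      · exact absurd hab hvu'
      · exact absurd hab (lt_irrefl _)
      · exact absurd hvi hnab
      · exact absurd hab hoi.asymm
      · exact absurd hab hui.lt.asymm
      · exact absurd hab hvi.lt.asymm
      · exact absurd hab (lt_irrefl _)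
    -- Each boundary chain has one inner element. These two are distinct and lie in the region,
    -- hence they are `u` and `v`.
    obtain ⟨w₁, how₁, hwi₁, rfl⟩ := h₁.eq_triple hI hou hui
    obtain ⟨w₂, how₂, hwi₂, rfl⟩ := h₂.eq_triple hI hou hui
    have hw : w₁ ≠ w₂ := by
      rintro rfl
      have : w₁ ∈ ({a, b} : Set L) := by rw [← hinter]; simp
      rcases this with h | h
      · exact how₁.ne' h
      · exact hwi₁.ne h
    have hr := hright w₂ ⟨by simp, by simp [how₂.ne', hwi₂.ne]⟩
    have hl' := (onLeft_iff_leftIn how₁ hwi₁ how₂ hwi₂ hw).2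
      ((onRight_iff_leftIn how₁ hwi₁ how₂ hwi₂ hw).1 hr)
    have hm₁ := hle ⟨⟨how₁.le, hwi₁.le⟩, onRight_self how₁ hwi₁ (by simp), hl'⟩
    have hm₂ := hle ⟨⟨how₂.le, hwi₂.le⟩, hr, onLeft_self how₂ hwi₂ (by simp)⟩
    have hn₁ : w₁ = u ∨ w₁ = v := by simpa [how₁.ne', hwi₁.ne] using hm₁
    have hn₂ : w₂ = u ∨ w₂ = v := by simpa [how₂.ne', hwi₂.ne] using hm₂
    have hmem : ∀ z ∈ ({w₁, w₂} : Set L), D.OnRight {a, w₁, b} z ∧ D.OnLeft {a, w₂, b} z := by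
      rintro z (rfl | rfl)
      · exact ⟨onRight_self how₁ hwi₁ (by simp), hl'⟩
      · exact ⟨hr, onLeft_self how₂ hwi₂ (by simp)⟩
    have hu : u ∈ ({w₁, w₂} : Set L) := by
      rcases hn₁ with rfl | rfl <;> rcases hn₂ with rfl | rfl <;> simp_all
    have hv : v ∈ ({w₁, w₂} : Set L) := by
      rcases hn₁ with rfl | rfl <;> rcases hn₂ with rfl | rfl <;> simp_all
    rintro z (rfl | rfl | rfl | rfl)
    · exact ⟨⟨le_rfl, hab.le⟩, onRight_self how₁ hwi₁ (by simp), onLeft_self how₂ hwi₂ (by simp)⟩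
    · exact ⟨⟨hou.le, hui.le⟩, hmem _ hu⟩
    · exact ⟨⟨hov.le, hvi.le⟩, hmem _ hv⟩
    · exact ⟨⟨hab.le, le_rfl⟩, onRight_self how₁ hwi₁ (by simp), onLeft_self how₂ hwi₂ (by simp)⟩

end Order

end PlanarDiagram

/-! ### Congruences generated by closed sets of edges. -/

section Congruence

variable {L : Type*} [Lattice L] {T : L → L → Prop}

theorem Relation.ReflTransGen.le_of_covBy (hT : ∀ a b, T a b → a ⋖ b) {a b : L}
    (h : Relation.ReflTransGen T a b) : a ≤ b := by
  induction h with
  | refl => exact le_rfl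
  | tail _ h ih => exact ih.trans (hT _ _ h).le

theorem Relation.ReflTransGen.of_covBy (hT : ∀ a b, T a b → a ⋖ b) {a b : L} (hab : a ⋖ b)
    (h : Relation.ReflTransGen T a b) : T a b := by
  rcases h.cases_head with rfl | ⟨c, hac, hcb⟩
  · exact absurd rfl hab.ne
  · rcases hab.eq_or_eq (hT _ _ hac).le (hcb.le_of_covBy hT) with rfl | rfl
    · exact absurd rfl (hT _ _ hac).ne
    · exact hac

/-- The edge is pushed up along covers from `x` to `w`, until its top is absorbed or `w` is reached.
-/
theorem le_or_sup_of_upper_closed [Finite L] (hT : ∀ a b, T a b → a ⋖ b)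
    (hup : ∀ x y z, T x y → x ⋖ z → y ≠ z → T z (y ⊔ z)) {x y w : L} (h : T x y) (hxw : x ≤ w) :
    y ≤ w ∨ T w (y ⊔ w) := by
  induction x using WellFoundedGT.induction generalizing y with
  | _ x ih =>
    rcases hxw.eq_or_lt with rfl | hlt
    · exact Or.inr ((sup_eq_left.2 (hT _ _ h).le).symm ▸ h)
    · obtain ⟨z, hz, hzw⟩ := exists_covBy_le_of_lt hlt
      by_cases hyz : y = z
      · exact Or.inl (hyz ▸ hzw)
      · have h' := ih z hz.lt (hup x y z h hz hyz) hzw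
        rw [sup_assoc, sup_eq_right.2 hzw] at h'
        exact h'.imp_left le_sup_left.trans

/-- The lattice congruence generated by a set of edges that is closed upwards and downwards. -/
def LatticeCon.ofEdges [Finite L] (hT : ∀ a b, T a b → a ⋖ b)
    (hup : ∀ x y z, T x y → x ⋖ z → y ≠ z → T z (y ⊔ z))
    (hdown : ∀ x y w, T y x → w ≤ x → Relation.ReflTransGen T (y ⊓ w) w) : LatticeCon L where
  r := Relation.EqvGen T
  iseqv := Relation.EqvGen.is_equivalence T
  inf := by
    have key : ∀ z a b, Relation.EqvGen T a b → Relation.EqvGen T (a ⊓ z) (b ⊓ z) := by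
      intro z a b h
      induction h with
      | rel a b h =>
        have := hdown b a (b ⊓ z) h inf_le_left
        rw [← inf_assoc, inf_eq_left.2 (hT _ _ h).le] at this
        exact Relation.EqvGen.reflTransGen_le_eqvGen _ _ _ this
      | refl a => exact .refl _
      | symm _ _ _ ih => exact ih.symm
      | trans _ _ _ _ _ ih ih' => exact ih.trans _ _ _ ih'
    intro a b c d h h'
    refine (key c _ _ h).trans _ _ _ ?_
    rw [inf_comm b c, inf_comm b d]
    exact key b _ _ h'
  sup := by
    have key : ∀ z a b, Relation.EqvGen T a b → Relation.EqvGen T (a ⊔ z) (b ⊔ z) := by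
      intro z a b h
      induction h with
      | rel a b h =>
        have hab := (hT _ _ h).le
        rcases le_or_sup_of_upper_closed hT hup h (le_sup_left : a ≤ a ⊔ z) with h' | h'
        · rw [le_antisymm (sup_le_sup_right hab z) (sup_le h' le_sup_right)]
          exact .refl _
        · rw [← sup_assoc, sup_eq_left.2 hab] at h'
          exact .rel _ _ h'
      | refl a => exact .refl _
      | symm _ _ _ ih => exact ih.symm
      | trans _ _ _ _ _ ih ih' => exact ih.trans _ _ _ ih'
    intro a b c d h h'
    refine (key c _ _ h).trans _ _ _ ?_
    rw [sup_comm b c, sup_comm b d]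
    exact key b _ _ h'

/-- If `T c d` fails, then `x ↦ (x ⊔ c) ⊓ d`, with values in `{c, d}`, is constant along edges of
`T`. A jump from `c` to `d` on an edge would, after joining with `c` and meeting with `d`, leave a
path in `T` from `c` to `d`. Being invariant, the map takes equal values at `c` and `d`, which is
absurd. -/
theorem edge_of_eqvGen [Finite L] (hT : ∀ a b, T a b → a ⋖ b)
    (hup : ∀ x y z, T x y → x ⋖ z → y ≠ z → T z (y ⊔ z))
    (hdown : ∀ x y w, T y x → w ≤ x → Relation.ReflTransGen T (y ⊓ w) w) {c d : L} (hcd : c ⋖ d)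
    (h : Relation.EqvGen T c d) : T c d := by
  by_contra hn
  have key : ∀ a b, Relation.EqvGen T a b → (a ⊔ c) ⊓ d = (b ⊔ c) ⊓ d := by
    intro a b h
    induction h with
    | rel a b h =>
      have hab := (hT _ _ h).le
      rcases le_or_sup_of_upper_closed hT hup h (le_sup_left : a ≤ a ⊔ c) with h' | h'
      · rw [le_antisymm (sup_le_sup_right hab c) (sup_le h' le_sup_right)]
      · rw [← sup_assoc, sup_eq_left.2 hab] at h'
        rcases hcd.eq_or_eq (le_inf (le_sup_right : c ≤ b ⊔ c) hcd.le) inf_le_right with h1 | h1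
        · refine le_antisymm (inf_le_inf_right d (sup_le_sup_right hab c)) ?_
          rw [h1]
          exact le_inf le_sup_right hcd.le
        rcases hcd.eq_or_eq (le_inf (le_sup_right : c ≤ a ⊔ c) hcd.le) inf_le_right with h2 | h2
        · have := hdown _ _ d h' (inf_eq_right.1 h1)
          rw [h2] at this
          exact absurd (this.of_covBy hT hcd) hn
        · rw [h1, h2]
    | refl a => rfl
    | symm _ _ _ ih => exact ih.symm
    | trans _ _ _ _ _ ih ih' => exact ih.trans ih'
  have := key c d h
  rw [sup_idem, inf_eq_left.2 hcd.le, sup_eq_left.2 hcd.le, inf_idem] at this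
  exact hcd.ne this

end Congruence

/-! ### Covers in semimodular and in general lattices. -/

/-- For an atom `a ≠ u` of the interval below `z`, semimodularity gives `a ⋖ a ⊔ u = i`, which
leaves only `z = a`. -/
theorem covBy_of_mem_Icc_of_covBy {L : Type*} [Lattice L] [Finite L] [IsUpperModularLattice L]
    {o u i z : L} (hou : o ⋖ u) (hui : u ⋖ i) (hz : z ∈ Set.Icc o i) :
    z = o ∨ z = i ∨ (o ⋖ z ∧ z ⋖ i) := by
  by_cases hzo : z = o
  · exact Or.inl hzo
  by_cases hzi : z = i
  · exact Or.inr (Or.inl hzi)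
  refine Or.inr (Or.inr ?_)
  obtain ⟨a, hoa, haz⟩ := exists_covBy_le_of_lt (lt_of_le_of_ne hz.1 (Ne.symm hzo))
  obtain ⟨b, hzb, hbi⟩ := exists_le_covBy_of_lt (lt_of_le_of_ne hz.2 hzi)
  by_cases hau : a = u
  · subst hau
    obtain rfl : a = b := (hui.eq_or_eq (haz.trans hzb) hbi.le).elim Eq.symm fun h =>
      absurd h hbi.ne
    obtain rfl := le_antisymm haz hzb
    exact ⟨hou, hui⟩
  · have hinf : a ⊓ u = o := by
      rcases hoa.eq_or_eq (le_inf hoa.le hou.le) inf_le_left with h | h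
      · exact h
      · rcases hou.eq_or_eq hoa.le (inf_eq_left.1 h) with h' | h'
        · exact absurd h' hoa.ne'
        · exact absurd h' hau
    have h1 : a ⋖ a ⊔ u := covBy_sup_of_inf_covBy_right (by rwa [hinf])
    have h2 : u ⋖ a ⊔ u := covBy_sup_of_inf_covBy_left (by rwa [hinf])
    have h3 : a ⊔ u = i := by
      rcases hui.eq_or_eq h2.le (sup_le (haz.trans hz.2) hui.le) with h | h
      · exact absurd h h2.ne'
      · exact h
    rw [h3] at h1
    obtain rfl : a = b := (h1.eq_or_eq (haz.trans hzb) hbi.le).elim Eq.symm fun h =>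
      absurd h hbi.ne
    obtain rfl := le_antisymm haz hzb
    exact ⟨hoa, h1⟩

theorem CovBy.inf_eq_of_ne {L : Type*} [Lattice L] {o u v : L} (hu : o ⋖ u) (hv : o ⋖ v)
    (h : u ≠ v) : u ⊓ v = o := by
  rcases hu.eq_or_eq (le_inf hu.le hv.le) inf_le_left with h' | h'
  · exact h'
  · rcases hv.eq_or_eq hu.le (inf_eq_left.1 h') with h'' | h''
    · exact absurd h'' hu.ne'
    · exact absurd h'' h

theorem CovBy.sup_eq_of_ne {L : Type*} [Lattice L] {i u v : L} (hu : u ⋖ i) (hv : v ⋖ i)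
    (h : u ≠ v) : u ⊔ v = i := by
  rcases hu.eq_or_eq le_sup_left (sup_le hu.le hv.le) with h' | h'
  · rcases hv.eq_or_eq (sup_eq_left.1 h') hu.le with h'' | h''
    · exact absurd h'' h
    · exact absurd h'' hu.ne
  · exact h'

/-! ### Edges reachable by SSL-sequences and their closure properties. -/

namespace PlanarDiagram

variable {L : Type*} [Lattice L] {D : PlanarDiagram L}

theorem IsFourCell.symm {o u v i : L} (h : D.IsFourCell o u v i) : D.IsFourCell o v u i := by
  obtain ⟨h, hne, h1, h2, h3, h4⟩ := h
  refine ⟨?_, hne.symm, h2, h1, h4, h3⟩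
  rwa [Set.insert_comm v u]

/-- One step of an SSL-sequence. -/
def SSLStep (D : PlanarDiagram L) (r s : PrimeInterval L) : Prop :=
  D.CellPerspective r s ∨ D.Tilts r s ∨ D.StronglySwings r s

/-- `[a, b]` is an edge reachable from `p` by an SSL-sequence. -/
def Reach (D : PlanarDiagram L) (p : PrimeInterval L) (a b : L) : Prop :=
  ∃ h : a ⋖ b, Relation.ReflTransGen D.SSLStep p ⟨a, b, h⟩

variable {p : PrimeInterval L}

theorem Reach.covBy {a b : L} (h : D.Reach p a b) : a ⋖ b := h.1

theorem Reach.step {r : PrimeInterval L} (h : D.Reach p r.bot r.top) {s : PrimeInterval L}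
    (hs : D.SSLStep r s) : D.Reach p s.bot s.top :=
  ⟨s.covBy, h.2.tail hs⟩

theorem Reach.perspective_up {o u v i : L} (h : D.Reach p o u) (hc : D.IsFourCell o u v i) :
    D.Reach p v i :=
  Reach.step (r := ⟨o, u, h.1⟩) h (s := ⟨v, i, hc.2.2.2.2.2⟩)
    (Or.inl ⟨o, u, v, i, hc, Or.inl ⟨rfl, rfl, rfl, rfl⟩⟩)

theorem Reach.perspective_down {o u v i : L} (h : D.Reach p v i) (hc : D.IsFourCell o u v i) :
    D.Reach p o u :=
  Reach.step (r := ⟨v, i, h.1⟩) h (s := ⟨o, u, hc.2.2.1⟩)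
    (Or.inl ⟨o, u, v, i, hc, Or.inr ⟨rfl, rfl, rfl, rfl⟩⟩)

theorem IsFourCell.sameFourCell_bot {o u v i : L} (hc : D.IsFourCell o u v i) :
    D.SameFourCell ⟨o, u, hc.2.2.1⟩ ⟨o, v, hc.2.2.2.1⟩ :=
  ⟨o, u, v, i, hc, by rintro t (rfl | rfl) <;> simp⟩

theorem IsFourCell.sameFourCell_top {o u v i : L} (hc : D.IsFourCell o u v i) :
    D.SameFourCell ⟨u, i, hc.2.2.2.2.1⟩ ⟨v, i, hc.2.2.2.2.2⟩ :=
  ⟨o, u, v, i, hc, by rintro t (rfl | rfl) <;> simp⟩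

theorem Reach.tilt_of_not_extreme {o u v i : L} (h : D.Reach p o u) (hc : D.IsFourCell o u v i)
    (h3 : 3 ≤ {b : L | o ⋖ b}.ncard) (hl : ¬ D.IsLeftmostCover o v)
    (hr : ¬ D.IsRightmostCover o v) : D.Reach p o v :=
  Reach.step (r := ⟨o, u, h.1⟩) h (s := ⟨o, v, hc.2.2.2.1⟩)
    (Or.inr (Or.inl ⟨by simpa using hc.2.1, hc.sameFourCell_bot, rfl, h3, hl, hr⟩))

omit [Lattice L] in
theorem three_le_ncard [Finite L] {S : Set L} {a b c : L} (ha : a ∈ S) (hb : b ∈ S) (hc : c ∈ S)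
    (hab : a ≠ b) (hbc : b ≠ c) (hac : a ≠ c) : 3 ≤ S.ncard := by
  have h : ({a, b, c} : Set L).ncard = 3 := Set.ncard_eq_three.2 ⟨a, b, c, hab, hac, hbc, rfl⟩
  rw [← h]
  refine Set.ncard_le_ncard ?_ (Set.toFinite S)
  rintro z (rfl | rfl | rfl) <;> assumption

variable [Finite L]

theorem Reach.tilt {o u v i w : L} (h : D.Reach p o u) (hc : D.IsFourCell o u v i) (hw : o ⋖ w)
    (hb : Btw (fun z => D.slope o z) u v w) : D.Reach p o v := by
  obtain ⟨h1, h2, h3⟩ := hb.ne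
  obtain ⟨hl, hr⟩ := D.not_extreme_upper_of_btw hc.2.2.1 hc.2.2.2.1 hw hb
  exact h.tilt_of_not_extreme hc (three_le_ncard hc.2.2.1 hc.2.2.2.1 hw h1 h2 h3) hl hr

/-- If `u` is not an eye, the swing is strong. If it is, the detour from `[u, i]` down to `[o, v]`,
by a tilt to `[o, u]`, and up to `[v, i]` works, since an eye is not an extreme cover of `o`. -/
theorem Reach.swing {o u v i w : L} (h : D.Reach p u i) (hc : D.IsFourCell o u v i) (hw : w ⋖ i)
    (hb : Btw (fun z => D.slope z i) u v w) : D.Reach p v i := by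
  by_cases he : D.IsEye u
  · obtain ⟨-, hs, o', ho', h3, hl, hr⟩ := he
    -- Two different lower covers would join to `u`, contradicting join-irreducibility.
    obtain rfl : o' = o := by
      by_contra hne
      rcases hs.2 (ho'.sup_eq_of_ne hc.2.2.1 hne) with h | h
      · exact ho'.ne h
      · exact hc.2.2.1.ne h
    exact ((h.perspective_down hc.symm).tilt_of_not_extreme hc.symm h3 hl hr).perspective_up hc
  · obtain ⟨h1, h2, h3⟩ := hb.ne
    obtain ⟨hl, hr⟩ := D.not_extreme_lower_of_btw hc.2.2.2.2.1 hc.2.2.2.2.2 hw hb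
    exact Reach.step (r := ⟨u, i, h.1⟩) h (s := ⟨v, i, hc.2.2.2.2.2⟩)
      (Or.inr (Or.inr ⟨⟨by simpa using hc.2.1, hc.sameFourCell_top, rfl,
        three_le_ncard (S := {a | a ⋖ i}) hc.2.2.2.2.1 hc.2.2.2.2.2 hw h1 h2 h3, hl, hr⟩,
        fun h => absurd h he⟩))

variable [IsUpperModularLattice L]

theorem isFourCell_of_leftIn {o u v i : L} (hou : o ⋖ u) (hui : u ⋖ i)
    (hov : o ⋖ v) (hvi : v ⋖ i) (huv : u ≠ v)
    (hadj : ∀ w, o ⋖ w → w ⋖ i →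
      (D.LeftIn o i u w ∧ D.LeftIn o i w v) ∨ (D.LeftIn o i v w ∧ D.LeftIn o i w u) → False) :
    D.IsFourCell o u v i := by
  have hI : ∀ z ∈ Set.Icc o i, _ := fun z hz => covBy_of_mem_Icc_of_covBy hou hui hz
  rcases leftIn_total (D := D) hou hui hov hvi huv with hl | hl
  · exact ⟨isCell_of_leftIn hI hou hui hov hvi huv hl
      fun w h1 h2 h3 h4 => hadj w h1 h2 (Or.inl ⟨h3, h4⟩), huv, hou, hov, hui, hvi⟩
  · exact IsFourCell.symm ⟨isCell_of_leftIn hI hov hvi hou hui huv.symm hl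
      fun w h1 h2 h3 h4 => hadj w h1 h2 (Or.inr ⟨h3, h4⟩), huv.symm, hov, hou, hvi, hui⟩

/-- Neighbouring upper covers of an element span a 4-cell. -/
theorem isFourCell_of_adjacent_upper {o u v : L} (hou : o ⋖ u) (hov : o ⋖ v) (huv : u ≠ v)
    (hadj : ∀ w, o ⋖ w → ¬ Btw (fun z => D.slope o z) u w v) : D.IsFourCell o u v (u ⊔ v) := by
  have hinf := hou.inf_eq_of_ne hov huv
  have hui : u ⋖ u ⊔ v := covBy_sup_of_inf_covBy_right (by rwa [hinf])
  have hvi : v ⋖ u ⊔ v := covBy_sup_of_inf_covBy_left (by rwa [hinf])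
  refine isFourCell_of_leftIn hou hui hov hvi huv fun w how hwi h => hadj w how ?_
  rcases h with ⟨h1, h2⟩ | ⟨h1, h2⟩
  · exact Or.inl ⟨h1.slope_bot_lt hou hui how hwi, h2.slope_bot_lt how hwi hov hvi⟩
  · exact Or.inr ⟨h1.slope_bot_lt hov hvi how hwi, h2.slope_bot_lt how hwi hou hui⟩

/-- Neighbouring lower covers of an element span a 4-cell. -/
theorem isFourCell_of_adjacent_lower {u v i : L} (hui : u ⋖ i) (hvi : v ⋖ i) (huv : u ≠ v)
    (hadj : ∀ w, w ⋖ i → ¬ Btw (fun z => D.slope z i) u w v) : D.IsFourCell (u ⊓ v) u v i := by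
  have hlt : u ⊓ v < u := lt_of_le_of_ne inf_le_left fun h =>
    (hui.eq_or_eq (inf_eq_left.1 h) hvi.le).elim (fun h => huv h.symm) fun h => hvi.ne h
  have hlt' : u ⊓ v < v := lt_of_le_of_ne inf_le_right fun h =>
    (hvi.eq_or_eq (inf_eq_right.1 h) hui.le).elim huv fun h => hui.ne h
  obtain ⟨a, hoa, hau⟩ := exists_covBy_le_of_lt hlt
  obtain ⟨b, hob, hbv⟩ := exists_covBy_le_of_lt hlt'
  have hav : ¬ a ≤ v := fun h => hoa.lt.not_ge (le_inf hau h)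
  have hbu : ¬ b ≤ u := fun h => hob.lt.not_ge (le_inf h hbv)
  have hab : a ≠ b := by rintro rfl; exact hav hbv
  have hinf := hoa.inf_eq_of_ne hob hab
  have ha : a ⋖ a ⊔ b := covBy_sup_of_inf_covBy_right (by rwa [hinf])
  have hb : b ⋖ a ⊔ b := covBy_sup_of_inf_covBy_left (by rwa [hinf])
  -- Semimodularity does not give `u ⊓ v ⋖ u`, so planarity is used. Otherwise some lower cover `w`
  -- of `i` is above both `a` and `b`. As `w` is not between `u` and `v`, one of these is between
  -- `w` and the other, and `inf_le_of_btw` yields `b ≤ u` or `a ≤ v`.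
  have hsup : a ⊔ b = i := by
    by_contra hne
    obtain ⟨w, hw, hwi⟩ := exists_le_covBy_of_lt
      (lt_of_le_of_ne (sup_le (hau.trans hui.le) (hbv.trans hvi.le)) hne)
    have haw : a ≤ w := le_sup_left.trans hw
    have hbw : b ≤ w := le_sup_right.trans hw
    have h1 : w ≠ u := by rintro rfl; exact hbu hbw
    have h2 : w ≠ v := by rintro rfl; exact hav haw
    have h3 := (D.slope_top_injOn i).ne hwi hui h1
    have h4 := (D.slope_top_injOn i).ne hwi hvi h2
    have h5 := (D.slope_top_injOn i).ne hui hvi huv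
    have h6 := hadj w hwi
    have : Btw (fun z => D.slope z i) w u v ∨ Btw (fun z => D.slope z i) w v u := by
      unfold Btw at *
      grind
    rcases this with h | h
    · exact hbu ((le_inf hbw hbv).trans (D.inf_le_of_btw hwi hui hvi h))
    · exact hav ((le_inf haw hau).trans (D.inf_le_of_btw hwi hvi hui h))
  rw [hsup] at ha hb
  obtain rfl : u = a := (ha.eq_or_eq hau hui.le).resolve_right hui.ne
  obtain rfl : v = b := (hb.eq_or_eq hbv hvi.le).resolve_right hvi.ne
  refine isFourCell_of_leftIn hoa ha hob hb huv fun w how hwi h => hadj w hwi ?_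
  rcases h with ⟨h1, h2⟩ | ⟨h1, h2⟩
  · exact Or.inr ⟨h2.slope_top_lt how hwi hob hb, h1.slope_top_lt hoa ha how hwi⟩
  · exact Or.inl ⟨h2.slope_top_lt how hwi hoa ha, h1.slope_top_lt hob hb how hwi⟩

omit [Lattice L] [IsUpperModularLattice L] in
/-- Induction on the number of elements of `S` between two elements of `S`. -/
theorem btw_induction {S : Set L} {f : L → ℝ} {P : L → L → Prop}
    (adj : ∀ a ∈ S, ∀ c ∈ S, a ≠ c → (∀ b ∈ S, ¬ Btw f a b c) → P a c)
    (step : ∀ a ∈ S, ∀ b ∈ S, ∀ c ∈ S, Btw f a b c → (∀ d ∈ S, ¬ Btw f a d b) → P b c → P a c)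
    {a c : L} (ha : a ∈ S) (hc : c ∈ S) (hac : a ≠ c) : P a c := by
  induction hn : {b | b ∈ S ∧ Btw f a b c}.ncard using Nat.strong_induction_on generalizing a with
  | _ n ih =>
    by_cases h : ∃ b ∈ S, Btw f a b c
    -- The element closest to `a` has nothing between itself and `a`.
    · obtain ⟨b, ⟨hb, hbt⟩, hmin⟩ := Set.exists_min_image {b | b ∈ S ∧ Btw f a b c}
        (fun b => |f b - f a|) (Set.toFinite _) h
      refine step a ha b hb c hc hbt (fun d hd hdt => ?_) (ih _ ?_ hb hbt.ne.2.1 rfl)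
      · have h1 := hmin d ⟨hd, by unfold Btw at *; grind⟩
        rcases hdt with h | h
        · rw [abs_of_pos, abs_of_pos] at h1 <;> linarith [h.1, h.2]
        · rw [abs_of_neg, abs_of_neg] at h1 <;> linarith [h.1, h.2]
      · rw [← hn]
        refine Set.ncard_lt_ncard ⟨?_, fun hle => ?_⟩ (Set.toFinite _)
        · rintro d ⟨hd, hdt⟩
          exact ⟨hd, by unfold Btw at *; grind⟩
        · exact (hle ⟨hb, hbt⟩ : b ∈ S ∧ Btw f b b c).2.ne.1 rfl
    · push Not at h
      exact adj a ha c hc hac h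

/-- Neighbouring covers are handled by a perspectivity. Otherwise one tilts to the neighbour `b` of
`a` on the side of `c` and continues from `b`. The edge obtained is the right one: `b ⊔ c = a ⊔ c`,
because `b ≤ a ⊔ c` and `c ⋖ a ⊔ c`. -/
theorem Reach.upper_closed {x y z : L} (h : D.Reach p x y) (hz : x ⋖ z) (hyz : y ≠ z) :
    D.Reach p z (y ⊔ z) := by
  refine btw_induction (S := {w | x ⋖ w}) (f := fun w => D.slope x w)
    (P := fun y z => D.Reach p x y → D.Reach p z (y ⊔ z)) ?_ ?_ h.covBy hz hyz h
  · intro a ha c hc hac hadj h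
    exact h.perspective_up (isFourCell_of_adjacent_upper ha hc hac hadj)
  · intro a ha b hb c hc hbt hadj ih h
    have hr := ih (h.tilt (isFourCell_of_adjacent_upper ha hb hbt.ne.1 hadj) hc hbt)
    have hca : c ⋖ a ⊔ c := covBy_sup_of_inf_covBy_left
      (by rw [CovBy.inf_eq_of_ne ha hc hbt.ne.2.2]; exact ha)
    rwa [← (hca.eq_or_eq hr.covBy.le
      (sup_le (D.le_sup_of_btw ha hb hc hbt) le_sup_right)).resolve_left hr.covBy.ne']

-- The hypothesis concerns only edges below `v`, so the induction hypothesis of `Reach.lower_closed`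
-- can supply it.
omit [Finite L] [IsUpperModularLattice L] in
theorem reflTransGen_reach_inf {v w z : L}
    (h : ∀ a b, D.Reach p a b → b ≤ v → ∀ w ≤ b, Relation.ReflTransGen (D.Reach p) (a ⊓ w) w)
    (hc : Relation.ReflTransGen (D.Reach p) z v) (hw : w ≤ v) :
    Relation.ReflTransGen (D.Reach p) (z ⊓ w) w := by
  induction hc using Relation.ReflTransGen.head_induction_on with
  | refl => rw [inf_eq_right.2 hw]
  | head hab hbv ih =>
    rename_i a b
    have := h a b hab (hbv.le_of_covBy fun _ _ h => h.covBy) (b ⊓ w) inf_le_left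
    rw [← inf_assoc, inf_eq_left.2 hab.covBy.le] at this
    exact this.trans ih

/-- The conclusion is a path, since `y ⊓ w` need not be covered by `w`. It suffices to reach a lower
cover `z` of `x` with `w ≤ z`; below `z` the induction on `x` applies. -/
theorem Reach.lower_closed {x y w : L} (h : D.Reach p y x) (hw : w ≤ x) :
    Relation.ReflTransGen (D.Reach p) (y ⊓ w) w := by
  induction x using WellFoundedLT.induction generalizing y w with
  | _ x ih =>
    rcases hw.eq_or_lt with rfl | hlt
    · rw [inf_eq_left.2 h.covBy.le]
      exact .single h
    obtain ⟨z, hwz, hzx⟩ := exists_le_covBy_of_lt hlt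
    have ih' : ∀ v, v < x → ∀ a b, D.Reach p a b → b ≤ v → ∀ w ≤ b,
        Relation.ReflTransGen (D.Reach p) (a ⊓ w) w :=
      fun v hv a b hab hbv w hwb => ih b (hbv.trans_lt hv) hab hwb
    by_cases hyz : y = z
    · rw [hyz, inf_eq_right.2 hwz]
    have key : Relation.ReflTransGen (D.Reach p) (y ⊓ z) z := by
      refine btw_induction (S := {w | w ⋖ x}) (f := fun w => D.slope w x)
        (P := fun y z => D.Reach p y x → Relation.ReflTransGen (D.Reach p) (y ⊓ z) z)
        ?_ ?_ h.covBy hzx hyz h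
      · intro a ha c hc hac hadj h
        exact .single (h.perspective_down (isFourCell_of_adjacent_lower ha hc hac hadj).symm)
      -- Meeting the reachable edge `[a ⊓ b, b]` with `b ⊓ c` gives a path from `a ⊓ c` to `b ⊓ c`;
      -- swinging from `a` to `b` and continuing gives one from `b ⊓ c` to `c`.
      · intro a ha b hb c hc hbt hadj ihb h
        have hcell := isFourCell_of_adjacent_lower ha hb hbt.ne.1 hadj
        have h1 := ih' b (CovBy.lt hb) _ _ (h.perspective_down hcell.symm) le_rfl (b ⊓ c)
          inf_le_left
        have h2 : a ⊓ b ⊓ (b ⊓ c) = a ⊓ c := le_antisymm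
          (le_inf (inf_le_left.trans inf_le_left) (inf_le_right.trans inf_le_right))
          (le_inf (le_inf inf_le_left (D.inf_le_of_btw ha hb hc hbt))
            (le_inf (D.inf_le_of_btw ha hb hc hbt) inf_le_right))
        rw [h2] at h1
        exact h1.trans (ihb (h.swing hcell hc hbt))
    have := reflTransGen_reach_inf (ih' z hzx.lt) key hwz
    rwa [inf_assoc, inf_eq_right.2 hwz] at this

theorem reach_of_con {q : PrimeInterval L} (h : p.con.r q.bot q.top) :
    D.Reach p q.bot q.top := by
  have hT : ∀ a b, D.Reach p a b → a ⋖ b := fun _ _ h => h.covBy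
  have hup : ∀ x y z, D.Reach p x y → x ⋖ z → y ≠ z → D.Reach p z (y ⊔ z) :=
    fun _ _ _ h => h.upper_closed
  have hdown : ∀ x y w, D.Reach p y x → w ≤ x → Relation.ReflTransGen (D.Reach p) (y ⊓ w) w :=
    fun _ _ _ h => h.lower_closed
  exact edge_of_eqvGen hT hup hdown q.covBy
    (h (LatticeCon.ofEdges hT hup hdown) (.rel _ _ ⟨p.covBy, .refl⟩))

omit [Finite L] [IsUpperModularLattice L] in
theorem exists_isSSLSequence {q : PrimeInterval L} (h : Relation.ReflTransGen D.SSLStep p q) :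
    ∃ (n : ℕ) (r : Fin (n + 1) → PrimeInterval L), D.IsSSLSequence p q n r := by
  induction h using Relation.ReflTransGen.head_induction_on with
  | refl => exact ⟨0, fun _ => q, rfl, rfl, fun j => j.elim0⟩
  | head hab hbq ih =>
    rename_i a b
    obtain ⟨n, r, h0, hn, hs⟩ := ih
    refine ⟨n + 1, Fin.cons a r, rfl, ?_, ?_⟩
    · rw [← Fin.succ_last, Fin.cons_succ, hn]
    · intro j
      cases j using Fin.cases with
      | zero =>
        rw [Fin.castSucc_zero, Fin.cons_zero, Fin.cons_succ, h0]
        exact hab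
      | succ j =>
        rw [← Fin.succ_castSucc, Fin.cons_succ, Fin.cons_succ]
        exact hs j

/-! ### Every step preserves collapsing. -/

omit [Finite L] [IsUpperModularLattice L] in
theorem CellPerspective.con {r s : PrimeInterval L} (h : D.CellPerspective r s) (c : LatticeCon L)
    (hr : c.r r.bot r.top) : c.r s.bot s.top := by
  obtain ⟨o, u, v, i, ⟨-, huv, hou, hov, hui, hvi⟩, h⟩ := h
  rcases h with ⟨h1, h2, h3, h4⟩ | ⟨h1, h2, h3, h4⟩
  · have := c.sup hr (c.refl v)
    rwa [h1, h2, sup_eq_right.2 hov.le, hui.sup_eq_of_ne hvi huv, ← h3, ← h4] at this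
  · have := c.inf hr (c.refl u)
    rwa [h1, h2, inf_comm, hou.inf_eq_of_ne hov huv, inf_eq_right.2 hui.le, ← h3, ← h4] at this

-- Meeting with a lower cover `d` beyond `s.bot` and joining with `s.bot` turns `r` into `s`,
-- because `r.bot ⊓ d ≤ s.bot`.
omit [IsUpperModularLattice L] in
theorem Swings.con {r s : PrimeInterval L} (h : D.Swings r s) (c : LatticeCon L)
    (hr : c.r r.bot r.top) : c.r s.bot s.top := by
  obtain ⟨hne, -, htop, -, hl, hr'⟩ := h
  have hbot : r.bot ≠ s.bot := fun h => hne (PrimeInterval.ext h htop)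
  have hs : s.bot ⋖ r.top := htop ▸ s.covBy
  obtain ⟨d, hd, hbt⟩ := D.btw_lower_of_not_extreme r.covBy hs hbot hl hr'
  have h1 := c.sup (c.inf hr (c.refl d)) (c.refl s.bot)
  rwa [sup_eq_right.2 (D.inf_le_of_btw r.covBy hs hd hbt), inf_eq_right.2 hd.le,
    hd.sup_eq_of_ne hs hbt.ne.2.1.symm, htop] at h1

omit [IsUpperModularLattice L] in
theorem Tilts.con {r s : PrimeInterval L} (h : D.Tilts r s) (c : LatticeCon L)
    (hr : c.r r.bot r.top) : c.r s.bot s.top := by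
  obtain ⟨hne, -, hbot, -, hl, hr'⟩ := h
  have htop : r.top ≠ s.top := fun h => hne (PrimeInterval.ext hbot h)
  have hs : r.bot ⋖ s.top := hbot ▸ s.covBy
  obtain ⟨d, hd, hbt⟩ := D.btw_upper_of_not_extreme r.covBy hs htop hl hr'
  have h1 := c.inf (c.sup hr (c.refl d)) (c.refl s.top)
  rwa [inf_eq_right.2 (D.le_sup_of_btw r.covBy hs hd hbt), sup_eq_right.2 hd.le,
    hd.inf_eq_of_ne hs hbt.ne.2.1.symm, hbot] at h1

omit [IsUpperModularLattice L] in
theorem IsSLSequence.con {q : PrimeInterval L} {n : ℕ} {r : Fin (n + 1) → PrimeInterval L}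
    (h : D.IsSLSequence p q n r) : p.con.r q.bot q.top := by
  obtain ⟨h0, hn, hs⟩ := h
  intro c hc
  have key : ∀ j, c.r (r j).bot (r j).top := by
    intro j
    induction j using Fin.induction with
    | zero => rwa [h0]
    | succ j ih =>
      rcases hs j with h | h | h
      · exact h.con c ih
      · exact h.con c ih
      · exact h.con c ih
  rw [← hn]
  exact key _

omit [Finite L] [IsUpperModularLattice L] in
theorem IsSSLSequence.isSLSequence {q : PrimeInterval L} {n : ℕ}
    {r : Fin (n + 1) → PrimeInterval L} (h : D.IsSSLSequence p q n r) :
    D.IsSLSequence p q n r :=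
  ⟨h.1, h.2.1, fun j => (h.2.2 j).imp_right fun h' => h'.symm.imp_left fun h'' => h''.1⟩

end PlanarDiagram

/-- The strong swing lemma. -/
theorem mainTheorem1 {L : Type*} [Lattice L] [Finite L] [IsUpperModularLattice L]
    (D : PlanarDiagram L) (p q : PrimeInterval L) :
    ((∃ (n : ℕ) (r : Fin (n + 1) → PrimeInterval L), D.IsSLSequence p q n r) →
        p.con.r q.bot q.top) ∧
      ((∃ (n : ℕ) (r : Fin (n + 1) → PrimeInterval L), D.IsSSLSequence p q n r) →
        p.con.r q.bot q.top) ∧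
      (p.con.r q.bot q.top →
        ∃ (n : ℕ) (r : Fin (n + 1) → PrimeInterval L), D.IsSSLSequence p q n r) :=
  ⟨fun ⟨_, _, h⟩ => h.con, fun ⟨_, _, h⟩ => h.isSLSequence.con,
    fun h => PlanarDiagram.exists_isSSLSequence (PlanarDiagram.reach_of_con h).2⟩
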